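/- Let $G$ be a semisimple Lie group with Lie algebra $\mathfrak g$ and let $(M=G/H,g)$ be a homogeneous Riemannian space ($H$ a compact subgroup of $G$ with Lie algebra $\mathfrak h$, $g$ a $G$-invariant Riemannian metric) that is a geodesic orbit space: every geodesic of $(M,g)$ is an orbit of a one-parameter subgroup of $G$. Let $\mathfrak m$ be the orthogonal complement of $\mathfrak h$ in $\mathfrak g$ with respect to the Killing form of $\mathfrak g$, identified with the tangent space $T_{eH}M$, and let $(\cdot,\cdot)$ be the inner product on $\mathfrak m$ given by $g$ at $eH$. Let $\mathfrak k\supset\mathfrak h$ be a maximal compactly embedded subalgebra of $\mathfrak g$, and let $\mathfrak m_1,\mathfrak m_2\subset\mathfrak m$ be subspaces such that $\mathfrak m=\mathfrak m_1\oplus\mathfrak m_2$, $(\mathfrak m_1,\mathfrak m_2)=0$ and $\mathfrak k=\mathfrak h\oplus\mathfrak m_1$. Let $K^*$ be a compact Lie group with Lie algebra $\mathfrak k$, let $H^*$ be a closed subgroup of $K^*$ with Lie algebra $\mathfrak h$, and let $g^*$ be a $K^*$-invariant Riemannian metric on $M^*=K^*/H^*$ that induces the inner product $(\cdot,\cdot)|_{\mathfrak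 m_1}$ on $\mathfrak m_1\cong T_{eH^*}M^*$. Let $Y_1,\dots,Y_s$, $s=\dim\mathfrak m_2$, be a $(\cdot,\cdot)$-orthonormal basis of $\mathfrak m_2$. Then $\mathfrak g=\mathfrak h\oplus\mathfrak m_1\oplus\mathfrak m_2$ and, writing $V_{\mathfrak m_1}$ for the $\mathfrak m_1$-component of $V\in\mathfrak g$ in this decomposition, the Ricci curvatures $\mathrm{Ric}$ of $(M,g)$ at $eH$ and $\mathrm{Ric}^*$ of $(M^*,g^*)$ at $eH^*$ satisfy $$\mathrm{Ric}^*(X,X)=\mathrm{Ric}(X,X)-\frac12\sum_{1\le i<j\le s}\bigl([Y_i,Y_j]_{\mathfrak m_1},X\bigr)^2\qquad\text{for every }X\in\mathfrak m_1 .$$ -/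

import Mathlib

set_option maxSynthPendingDepth 3

open Set Filter
open scoped Manifold ContDiff Topology

noncomputable section

/-- A smooth Lie group is in particular of the regularity that the bracket on
`GroupLieAlgebra` asks for. -/
instance LieGroup.instMinSmoothnessOfInfty {E : Type*} [NormedAddCommGroup E] [NormedSpace ℝ E]
    {G : Type*} [TopologicalSpace G] [ChartedSpace E G] [Group G] [LieGroup 𝓘(ℝ, E) ∞ G] :
    LieGroup 𝓘(ℝ, E) (minSmoothness ℝ 3) G := by
  rw [minSmoothness_of_isRCLikeNormedField]
  exact inferInstanceAs (LieGroup 𝓘(ℝ, E) ((3 : ℕ) : ℕ∞ω) G)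

/-- The Lie algebra of a finite-dimensional Lie group is finite-dimensional. -/
instance GroupLieAlgebra.instFiniteDimensional {E : Type*} [NormedAddCommGroup E]
    [NormedSpace ℝ E] [FiniteDimensional ℝ E] {G : Type*} [TopologicalSpace G] [ChartedSpace E G]
    [Group G] : FiniteDimensional ℝ (GroupLieAlgebra 𝓘(ℝ, E) G) :=
  inferInstanceAs (FiniteDimensional ℝ E)

/-! ### Riemannian geometry in charts -/

/-- Smooth Riemannian metrics on a smooth manifold modelled on `E`. -/
abbrev RiemMetric (E : Type*) [NormedAddCommGroup E] [NormedSpace ℝ E] [FiniteDimensional ℝ E]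
    (M : Type*) [TopologicalSpace M] [ChartedSpace E M] [IsManifold 𝓘(ℝ, E) ∞ M] :=
  Bundle.ContMDiffRiemannianMetric 𝓘(ℝ, E) ∞ E (fun x : M => TangentSpace 𝓘(ℝ, E) x)

namespace RiemMetric

section

variable {E : Type*} [NormedAddCommGroup E] [NormedSpace ℝ E] [FiniteDimensional ℝ E]
  {M : Type*} [TopologicalSpace M] [ChartedSpace E M] [IsManifold 𝓘(ℝ, E) ∞ M]
  (g : RiemMetric E M)

/-- The derivative at the coordinate `y` of the parametrization inverse to the chart at `x₀`. -/
def chartFrame (x₀ : M) (y : E) :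
    E →L[ℝ] TangentSpace 𝓘(ℝ, E) ((extChartAt 𝓘(ℝ, E) x₀).symm y) :=
  (mfderiv 𝓘(ℝ, E) 𝓘(ℝ, E) (extChartAt 𝓘(ℝ, E) x₀).symm y :)

/-- The metric in the chart at `x₀`: the coefficients `g_{ij}` as a field of bilinear forms on the
target of the chart. -/
def coord (x₀ : M) (y : E) : E →L[ℝ] E →L[ℝ] ℝ :=
  let B : E →L[ℝ] E →L[ℝ] ℝ := g.inner ((extChartAt 𝓘(ℝ, E) x₀).symm y)
  let A : E →L[ℝ] E := chartFrame x₀ y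
  B.bilinearComp A A

theorem coord_apply (x₀ : M) (y u v : E) :
    g.coord x₀ y u v = g.inner ((extChartAt 𝓘(ℝ, E) x₀).symm y)
      (chartFrame x₀ y u) (chartFrame x₀ y v) := rfl

/-- `(u, v, w) ↦ ∂_u g(v, w) + ∂_v g(u, w) - ∂_w g(u, v)` in the chart at `x₀`: twice the
Christoffel symbols of the first kind. -/
def koszul (x₀ : M) (y : E) : E →L[ℝ] E →L[ℝ] E →L[ℝ] ℝ :=
  let D : E →L[ℝ] E →L[ℝ] E →L[ℝ] ℝ := fderiv ℝ (g.coord x₀) y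
  let T : (E →L[ℝ] E →L[ℝ] ℝ) →L[ℝ] E →L[ℝ] E →L[ℝ] ℝ :=
    (ContinuousLinearMap.flipₗᵢ ℝ E E ℝ).toContinuousLinearEquiv.toContinuousLinearMap
  D + D.flip - T ∘L D.flip

theorem koszul_apply (x₀ : M) (y u v w : E) :
    g.koszul x₀ y u v w = fderiv ℝ (g.coord x₀) y u v w + fderiv ℝ (g.coord x₀) y v u w
      - fderiv ℝ (g.coord x₀) y w u v := rfl

/-- The Christoffel symbols (of the second kind) of the Levi-Civita connection in the chart
at `x₀`, as a field of bilinear maps: `Γ^k_{ij} = ½ g^{kl} (∂_i g_{jl} + ∂_j g_{il} - ∂_l g_{ij})`. -/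
def christoffel (x₀ : M) (y : E) : E →L[ℝ] E →L[ℝ] E :=
  (1 / 2 : ℝ) • (ContinuousLinearMap.compL ℝ E (E →L[ℝ] ℝ) E (g.coord x₀ y).inverse ∘L
    g.koszul x₀ y)

theorem christoffel_apply (x₀ : M) (y u v : E) :
    g.christoffel x₀ y u v = (1 / 2 : ℝ) • (g.coord x₀ y).inverse (g.koszul x₀ y u v) := rfl

/-- In the chart at `x₀`, the linear map `u ↦ R(u, v) w`, where
`R(u, v) w = ∇_u ∇_v w - ∇_v ∇_u w - ∇_{[u, v]} w` is the Riemannian curvature tensor. -/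
def chartCurvature (x₀ : M) (y v w : E) : E →L[ℝ] E :=
  let Γ := g.christoffel x₀ y
  let DΓ : E →L[ℝ] E →L[ℝ] E →L[ℝ] E := fderiv ℝ (g.christoffel x₀) y
  (DΓ.flip v).flip w - (DΓ v).flip w + Γ.flip (Γ v w) - Γ v ∘L Γ.flip w

theorem chartCurvature_apply (x₀ : M) (y v w u : E) :
    g.chartCurvature x₀ y v w u =
      fderiv ℝ (g.christoffel x₀) y u v w - fderiv ℝ (g.christoffel x₀) y v u w
      + g.christoffel x₀ y u (g.christoffel x₀ y v w)
      - g.christoffel x₀ y v (g.christoffel x₀ y u w) := rfl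

/-- The Ricci curvature `Ric(v, w) = tr (u ↦ R(u, v) w)` at `x`, computed in the chart at `x`. -/
def ricci (x : M) (v w : TangentSpace 𝓘(ℝ, E) x) : ℝ :=
  let φ := extChartAt 𝓘(ℝ, E) x
  let dφ : TangentSpace 𝓘(ℝ, E) x →L[ℝ] E := mfderiv 𝓘(ℝ, E) 𝓘(ℝ, E) φ x
  LinearMap.trace ℝ E (g.chartCurvature x (φ x) (dφ v) (dφ w) : E →ₗ[ℝ] E)

/-- `γ` is a geodesic of `g` on the open set `J` of parameters: it is twice continuously
differentiable there and satisfies the geodesic equation `c'' + Γ(c', c') = 0` in local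
coordinates. The equation at a given time holds in one chart around `γ t` if and only if it holds
in all of them. -/
def IsGeodesicOn (γ : ℝ → M) (J : Set ℝ) : Prop :=
  ContMDiffOn 𝓘(ℝ, ℝ) 𝓘(ℝ, E) 2 γ J ∧
  ∀ t ∈ J, ∃ x₀ : M, γ t ∈ (chartAt E x₀).source ∧
    let c : ℝ → E := fun s => extChartAt 𝓘(ℝ, E) x₀ (γ s)
    deriv (deriv c) t + g.christoffel x₀ (c t) (deriv c t) (deriv c t) = 0

end

end RiemMetric

/-! ### Homogeneous Riemannian spaces -/

section

variable {F : Type*} [NormedAddCommGroup F] [NormedSpace ℝ F]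
  {G : Type*} [TopologicalSpace G] [ChartedSpace F G] [Group G]
  {E : Type*} [NormedAddCommGroup E] [NormedSpace ℝ E] [FiniteDimensional ℝ E]
  {M : Type*} [TopologicalSpace M] [ChartedSpace E M] [MulAction G M]

/-- The value at `o` of the vector field on `M` generated by an element of the Lie algebra of `G`,
that is, the derivative at `1` of the orbit map `a ↦ a • o`. -/
def infAction (F : Type*) [NormedAddCommGroup F] [NormedSpace ℝ F]
    (G : Type*) [TopologicalSpace G] [ChartedSpace F G] [Group G]
    {E : Type*} [NormedAddCommGroup E] [NormedSpace ℝ E]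
    {M : Type*} [TopologicalSpace M] [ChartedSpace E M] [MulAction G M] (o : M) :
    GroupLieAlgebra 𝓘(ℝ, F) G →L[ℝ] TangentSpace 𝓘(ℝ, E) o :=
  (mfderiv 𝓘(ℝ, F) 𝓘(ℝ, E) (fun a : G => a • o) (1 : G) :)

/-- The Lie algebra of the isotropy group of `o`, as a subspace of the Lie algebra of `G`. -/
def isotropyAlgebra (F : Type*) [NormedAddCommGroup F] [NormedSpace ℝ F]
    (G : Type*) [TopologicalSpace G] [ChartedSpace F G] [Group G]
    {E : Type*} [NormedAddCommGroup E] [NormedSpace ℝ E]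
    {M : Type*} [TopologicalSpace M] [ChartedSpace E M] [MulAction G M] (o : M) :
    Submodule ℝ (GroupLieAlgebra 𝓘(ℝ, F) G) :=
  LinearMap.ker (infAction F G (E := E) o : GroupLieAlgebra 𝓘(ℝ, F) G →ₗ[ℝ] TangentSpace 𝓘(ℝ, E) o)

/-- `(M, g)` with base point `o` is the homogeneous Riemannian space `(G/H, g)`, where `H` is the
stabilizer of `o`, a compact subgroup of `G`: the Lie group `G` acts smoothly, transitively and by
isometries, and `a ↦ a • o` is a submersion, so that it induces a diffeomorphism of `G/H`
onto `M`. -/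
structure IsHomogeneousRiemannianSpace (F : Type*) [NormedAddCommGroup F] [NormedSpace ℝ F]
    (G : Type*) [TopologicalSpace G] [ChartedSpace F G] [Group G]
    {E : Type*} [NormedAddCommGroup E] [NormedSpace ℝ E] [FiniteDimensional ℝ E]
    {M : Type*} [TopologicalSpace M] [ChartedSpace E M] [IsManifold 𝓘(ℝ, E) ∞ M] [MulAction G M]
    (g : RiemMetric E M) (o : M) : Prop where
  smooth : ContMDiffSMul 𝓘(ℝ, F) 𝓘(ℝ, E) ∞ G M
  transitive : MulAction.IsPretransitive G M
  submersion : Function.Surjective (infAction F G (E := E) o)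
  isometric : ∀ (a : G) (x : M) (v w : TangentSpace 𝓘(ℝ, E) x),
    g.inner (a • x) (mfderiv 𝓘(ℝ, E) 𝓘(ℝ, E) (fun z : M => a • z) x v)
      (mfderiv 𝓘(ℝ, E) 𝓘(ℝ, E) (fun z : M => a • z) x w) = g.inner x v w
  compact_isotropy : IsCompact (MulAction.stabilizer G o : Set G)

/-- The geodesic orbit property of `(M, g)` with respect to `G`: every geodesic, on whatever open
interval of parameters it is given, is an orbit of a one-parameter subgroup of `G`. -/
def IsGeodesicOrbit (F : Type*) [NormedAddCommGroup F] [NormedSpace ℝ F]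
    (G : Type*) [TopologicalSpace G] [ChartedSpace F G] [Group G]
    {E : Type*} [NormedAddCommGroup E] [NormedSpace ℝ E] [FiniteDimensional ℝ E]
    {M : Type*} [TopologicalSpace M] [ChartedSpace E M] [IsManifold 𝓘(ℝ, E) ∞ M] [MulAction G M]
    (g : RiemMetric E M) : Prop :=
  ∀ (γ : ℝ → M) (J : Set ℝ), IsOpen J → J.OrdConnected → 0 ∈ J → g.IsGeodesicOn γ J →
    ∃ φ : ℝ → G, ContMDiff 𝓘(ℝ, ℝ) 𝓘(ℝ, F) ∞ φ ∧ (∀ s t, φ (s + t) = φ s * φ t) ∧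
      ∀ t ∈ J, γ t = φ t • γ 0

/-- The inner product `(X, Y)` that the metric at `o` induces through `X ↦ X(o)`. It is a scalar
product on every complement of the isotropy algebra, which `X ↦ X(o)` identifies with the tangent
space at `o`. -/
def homInner (F : Type*) [NormedAddCommGroup F] [NormedSpace ℝ F]
    (G : Type*) [TopologicalSpace G] [ChartedSpace F G] [Group G]
    {E : Type*} [NormedAddCommGroup E] [NormedSpace ℝ E] [FiniteDimensional ℝ E]
    {M : Type*} [TopologicalSpace M] [ChartedSpace E M] [IsManifold 𝓘(ℝ, E) ∞ M] [MulAction G M]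
    (g : RiemMetric E M) (o : M) (X Y : GroupLieAlgebra 𝓘(ℝ, F) G) : ℝ :=
  g.inner o (infAction F G o X) (infAction F G o Y)

/-- The Ricci curvature at `o` as a quadratic form on the Lie algebra, `Ric(X, X)`, through
`X ↦ X(o)`. -/
def homRicci (F : Type*) [NormedAddCommGroup F] [NormedSpace ℝ F]
    (G : Type*) [TopologicalSpace G] [ChartedSpace F G] [Group G]
    {E : Type*} [NormedAddCommGroup E] [NormedSpace ℝ E] [FiniteDimensional ℝ E]
    {M : Type*} [TopologicalSpace M] [ChartedSpace E M] [IsManifold 𝓘(ℝ, E) ∞ M] [MulAction G M]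
    (g : RiemMetric E M) (o : M) (X : GroupLieAlgebra 𝓘(ℝ, F) G) : ℝ :=
  g.ricci o (infAction F G o X) (infAction F G o X)

end

/-! ### Compactly embedded subalgebras -/

/-- A subalgebra `𝔨` of a finite-dimensional real Lie algebra `L` is compactly embedded if the
group of automorphisms of `L` generated by `exp (ad X)`, `X ∈ 𝔨`, is compact. The automorphisms are
written as matrices in a basis of `L`; the choice of the basis does not matter. -/
def IsCompactlyEmbedded {L : Type*} [LieRing L] [LieAlgebra ℝ L] [FiniteDimensional ℝ L]
    (𝔨 : LieSubalgebra ℝ L) : Prop :=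
  let b := Module.finBasis ℝ L
  IsCompact (Subgroup.closure
    {a : (Matrix (Fin (Module.finrank ℝ L)) (Fin (Module.finrank ℝ L)) ℝ)ˣ |
      ∃ X ∈ 𝔨, a.val = NormedSpace.exp (LinearMap.toMatrix b b (LieAlgebra.ad ℝ L X))} :
    Set (Matrix (Fin (Module.finrank ℝ L)) (Fin (Module.finrank ℝ L)) ℝ)ˣ)

end

set_option linter.unusedSectionVars false

/-! Let `q` be the pull-back to 𝔤 of the metric at `o`: a semidefinite form with null space 𝔥. The
fields generated by 𝔤 are Killing, so the Koszul formula expresses ∇ at `o` through `q` and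
brackets, and `metric_curv_killing` does the same for the curvature. Tracing gives
`homRicci_eq_sum`: Ric(X, X) is the algebraic expression `lieRicci` in a `q`-orthonormal family
spanning 𝔤 modulo 𝔥. For M this family is an orthonormal basis `a` of 𝔪₁ together with `Y`; for M⋆
it is `a` alone. Both curvatures are thus computed inside 𝔤, and only the terms involving `Y` have
to be evaluated.

The geodesic orbit property enters through `exists_geodesic_vector`: every X admits Z ∈ 𝔥 with q([X
+ Z, W], X) = 0 for all W. For X ∈ 𝔪₂ this makes the compression of ad U to 𝔪₂ skew for each U ∈ 𝔨.
For X ∈ 𝔨 it gives q([U, y], V) + q([V, y], U) = 0 for U, V ∈ 𝔨 and y ∈ 𝔪₂; geometrically, the orbit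
of `o` tangent to 𝔪₁ is totally geodesic, which removes the mixed terms. Finally it kills the term
⟨∇_X X, ∑ ∇_{e_i} e_i⟩ (`sum_meanCurvature_eq_zero`). What survives (`lieRicci_sumElim`) is ¼ ∑_k
q([Y_j, Y_k], X)² for each j, that is, ½ ∑_{i<j} in total. Projecting the brackets to 𝔪₁ changes
nothing, since X is `q`-orthogonal to 𝔥 + 𝔪₂.

Compact embeddedness and semisimplicity provide the splitting 𝔤 = 𝔥 ⊕ 𝔥^⊥: ad X is skew for some
scalar product when X ∈ 𝔥, so the Killing form is definite on 𝔥. -/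

noncomputable section

/-! ### Curvature of Killing fields on an open subset of a vector space. -/

section LocalGeometry

variable {E : Type*} [NormedAddCommGroup E] [NormedSpace ℝ E]

/-- `Γ` is the Levi-Civita connection of the metric `B` on the open subset `T` of a vector
space. -/
structure IsLeviCivitaOn (B : E → E →L[ℝ] E →L[ℝ] ℝ) (Γ : E → E →L[ℝ] E →L[ℝ] E)
    (T : Set E) : Prop where
  isOpen : IsOpen T
  contDiffOn_metric : ContDiffOn ℝ ∞ B T
  contDiffOn_connection : ContDiffOn ℝ ∞ Γ T
  symm : ∀ y ∈ T, ∀ u v, B y u v = B y v u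
  pos : ∀ y ∈ T, ∀ u, u ≠ 0 → 0 < B y u u
  torsion_free : ∀ y ∈ T, ∀ u v, Γ y u v = Γ y v u
  metric_compat : ∀ y ∈ T, ∀ u v w, fderiv ℝ B y u v w = B y (Γ y u v) w + B y v (Γ y u w)

/-- The covariant derivative `∇_u V` at `y`. -/
def covDeriv (Γ : E → E →L[ℝ] E →L[ℝ] E) (V : E → E) (y u : E) : E :=
  fderiv ℝ V y u + Γ y u (V y)

/-- The curvature `R(u, v) w` of the connection `Γ`. -/
def curv (Γ : E → E →L[ℝ] E →L[ℝ] E) (y v w u : E) : E :=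
  fderiv ℝ Γ y u v w - fderiv ℝ Γ y v u w + Γ y u (Γ y v w) - Γ y v (Γ y u w)

/-- `V` is a smooth Killing vector field of `B` on `T`. -/
structure IsKillingOn (B : E → E →L[ℝ] E →L[ℝ] ℝ) (T : Set E) (V : E → E) : Prop where
  contDiffOn : ContDiffOn ℝ ∞ V T
  killing : ∀ y ∈ T, ∀ u v,
    fderiv ℝ B y (V y) u v + B y (fderiv ℝ V y u) v + B y u (fderiv ℝ V y v) = 0

variable {B : E → E →L[ℝ] E →L[ℝ] ℝ} {Γ : E → E →L[ℝ] E →L[ℝ] E} {T : Set E} {y : E}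
  {V W X Y Z : E → E}

namespace IsLeviCivitaOn

theorem fderiv_metric (h : IsLeviCivitaOn B Γ T) (hy : y ∈ T) (hV : DifferentiableAt ℝ V y)
    (hW : DifferentiableAt ℝ W y) (u : E) :
    fderiv ℝ (fun z => B z (V z) (W z)) y u =
      B y (covDeriv Γ V y u) (W y) + B y (V y) (covDeriv Γ W y u) := by
  have hB : DifferentiableAt ℝ B y :=
    (h.contDiffOn_metric.contDiffAt (h.isOpen.mem_nhds hy)).differentiableAt (by simp)
  have h1 := (hB.hasFDerivAt.clm_apply hV.hasFDerivAt).clm_apply hW.hasFDerivAt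
  rw [h1.fderiv]
  simp only [covDeriv, map_add, add_apply, ContinuousLinearMap.coe_comp,
    Function.comp_apply, ContinuousLinearMap.flip_apply]
  rw [h.metric_compat y hy]
  ring

theorem lieBracket_eq (h : IsLeviCivitaOn B Γ T) (hy : y ∈ T) (V W : E → E) :
    VectorField.lieBracket ℝ V W y = covDeriv Γ W y (V y) - covDeriv Γ V y (W y) := by
  simp only [VectorField.lieBracket, covDeriv, h.torsion_free y hy (V y) (W y)]
  abel

theorem differentiableAt_of_contDiffOn (h : IsLeviCivitaOn B Γ T) (hy : y ∈ T)
    (hV : ContDiffOn ℝ ∞ V T) : DifferentiableAt ℝ V y :=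
  (hV.contDiffAt (h.isOpen.mem_nhds hy)).differentiableAt (by simp)

theorem contDiffOn_fderiv_apply (h : IsLeviCivitaOn B Γ T) (hV : ContDiffOn ℝ ∞ V T)
    (hW : ContDiffOn ℝ ∞ W T) : ContDiffOn ℝ ∞ (fun z => fderiv ℝ W z (V z)) T :=
  (hW.fderiv_of_isOpen h.isOpen (by simp)).clm_apply hV

theorem contDiffOn_covDeriv (h : IsLeviCivitaOn B Γ T) (hV : ContDiffOn ℝ ∞ V T)
    (hW : ContDiffOn ℝ ∞ W T) : ContDiffOn ℝ ∞ (fun z => covDeriv Γ W z (V z)) T :=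
  (h.contDiffOn_fderiv_apply hV hW).add ((h.contDiffOn_connection.clm_apply hV).clm_apply hW)

theorem contDiffOn_lieBracket (h : IsLeviCivitaOn B Γ T) (hV : ContDiffOn ℝ ∞ V T)
    (hW : ContDiffOn ℝ ∞ W T) : ContDiffOn ℝ ∞ (VectorField.lieBracket ℝ V W) T :=
  (h.contDiffOn_fderiv_apply hV hW).sub (h.contDiffOn_fderiv_apply hW hV)

/-- The second derivatives of `W` cancel by symmetry, and the derivatives of `X` and `Y` are
absorbed by the bracket term. -/
theorem curv_eq (h : IsLeviCivitaOn B Γ T) (hy : y ∈ T) (hX : ContDiffOn ℝ ∞ X T)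
    (hY : ContDiffOn ℝ ∞ Y T) (hW : ContDiffOn ℝ ∞ W T) :
    curv Γ y (Y y) (W y) (X y) =
      covDeriv Γ (fun z => covDeriv Γ W z (Y z)) y (X y)
      - covDeriv Γ (fun z => covDeriv Γ W z (X z)) y (Y y)
      - covDeriv Γ W y (VectorField.lieBracket ℝ X Y y) := by
  have hT := h.isOpen.mem_nhds hy
  have hΓ : DifferentiableAt ℝ Γ y :=
    (h.contDiffOn_connection.contDiffAt hT).differentiableAt (by simp)
  have hdW : DifferentiableAt ℝ (fderiv ℝ W) y :=
    ((hW.fderiv_of_isOpen (m := ∞) h.isOpen (by simp)).contDiffAt hT).differentiableAt (by simp)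
  have hWy := h.differentiableAt_of_contDiffOn hy hW
  have key : ∀ {V : E → E}, ContDiffOn ℝ ∞ V T → ∀ u,
      fderiv ℝ (fun z => covDeriv Γ W z (V z)) y u = fderiv ℝ (fderiv ℝ W) y u (V y)
        + fderiv ℝ W y (fderiv ℝ V y u) + fderiv ℝ Γ y u (V y) (W y)
        + Γ y (fderiv ℝ V y u) (W y) + Γ y (V y) (fderiv ℝ W y u) := by
    intro V hV u
    have hVy := h.differentiableAt_of_contDiffOn hy hV
    have h1 := (hdW.hasFDerivAt.clm_apply hVy.hasFDerivAt).add
      ((hΓ.hasFDerivAt.clm_apply hVy.hasFDerivAt).clm_apply hWy.hasFDerivAt)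
    have h2 : fderiv ℝ (fun z => covDeriv Γ W z (V z)) y = _ := h1.fderiv
    rw [h2]
    simp only [add_apply, ContinuousLinearMap.coe_comp,
      Function.comp_apply, ContinuousLinearMap.flip_apply]
    abel
  have hsymm : fderiv ℝ (fderiv ℝ W) y (X y) (Y y) = fderiv ℝ (fderiv ℝ W) y (Y y) (X y) :=
    ((hW.contDiffAt hT).isSymmSndFDerivAt (by simpa using ENat.LEInfty.out)).eq _ _
  have e1 : ∀ (V : E → E) u, covDeriv Γ V y u = fderiv ℝ V y u + Γ y u (V y) := fun _ _ => rfl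
  rw [e1 (fun z => covDeriv Γ W z (Y z)), e1 (fun z => covDeriv Γ W z (X z)), key hX, key hY]
  simp only [curv, covDeriv, VectorField.lieBracket, map_add, map_sub,
    sub_apply, hsymm]
  abel

theorem killing_skew (h : IsLeviCivitaOn B Γ T) (hX : IsKillingOn B T X) (hy : y ∈ T) (u v : E) :
    B y (covDeriv Γ X y u) v + B y u (covDeriv Γ X y v) = 0 := by
  have h1 := hX.killing y hy u v
  rw [h.metric_compat y hy, h.torsion_free y hy _ u, h.torsion_free y hy _ v] at h1
  simp only [covDeriv, map_add, add_apply]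
  linarith

/-- The Koszul formula for Killing fields. -/
theorem koszul_killing (h : IsLeviCivitaOn B Γ T) (hX : IsKillingOn B T X)
    (hY : IsKillingOn B T Y) (hZ : IsKillingOn B T Z) (hy : y ∈ T) :
    2 * B y (covDeriv Γ Y y (X y)) (Z y) =
      B y (VectorField.lieBracket ℝ X Y y) (Z y) + B y (VectorField.lieBracket ℝ X Z y) (Y y)
      + B y (VectorField.lieBracket ℝ Y Z y) (X y) := by
  simp only [h.lieBracket_eq hy, map_sub, sub_apply]
  have h1 := h.killing_skew hX hy (Y y) (Z y)
  have h2 := h.killing_skew hY hy (X y) (Z y)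
  have h3 := h.killing_skew hZ hy (X y) (Y y)
  rw [h.symm y hy _ (covDeriv Γ X y (Z y))] at h1
  rw [h.symm y hy _ (covDeriv Γ Y y (Z y))] at h2
  rw [h.symm y hy _ (covDeriv Γ Z y (Y y))] at h3
  linarith

/-- The Koszul formula with two equal arguments. It translates ∇_Y Y = 0 into the algebraic
condition on geodesic vectors. -/
theorem metric_covDeriv_self (h : IsLeviCivitaOn B Γ T) (hX : IsKillingOn B T X)
    (hY : IsKillingOn B T Y) (hy : y ∈ T) :
    B y (covDeriv Γ Y y (Y y)) (X y) = B y (VectorField.lieBracket ℝ Y X y) (Y y) := by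
  have h1 := h.koszul_killing hY hY hX hy
  simp only [VectorField.lieBracket_self, Pi.zero_apply, map_zero,
    zero_apply] at h1
  linarith

/-- The Lie derivative of the metric along `X` vanishes, so `X` acts on a product of fields through
brackets alone. -/
theorem fderiv_metric_killing (h : IsLeviCivitaOn B Γ T) (hX : IsKillingOn B T X) (hy : y ∈ T)
    (hV : DifferentiableAt ℝ V y) (hW : DifferentiableAt ℝ W y) :
    fderiv ℝ (fun z => B z (V z) (W z)) y (X y) =
      B y (VectorField.lieBracket ℝ X V y) (W y) + B y (V y) (VectorField.lieBracket ℝ X W y) := by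
  rw [h.fderiv_metric hy hV hW, h.lieBracket_eq hy, h.lieBracket_eq hy]
  have h1 := h.killing_skew hX hy (V y) (W y)
  simp only [map_sub, sub_apply]
  linarith

/-- The sectional curvature of Killing fields. -/
theorem metric_curv_killing (h : IsLeviCivitaOn B Γ T) (hX : IsKillingOn B T X)
    (hY : IsKillingOn B T Y) (hy : y ∈ T) :
    B y (curv Γ y (Y y) (Y y) (X y)) (X y) =
      B y (VectorField.lieBracket ℝ X (VectorField.lieBracket ℝ Y X) y) (Y y)
      - B y (VectorField.lieBracket ℝ Y X y) (VectorField.lieBracket ℝ Y X y)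
      - B y (covDeriv Γ Y y (Y y)) (covDeriv Γ X y (X y))
      + B y (covDeriv Γ Y y (X y)) (covDeriv Γ Y y (X y)) := by
  have hT := h.isOpen.mem_nhds hy
  have cX := hX.contDiffOn
  have cY := hY.contDiffOn
  have dX := h.differentiableAt_of_contDiffOn hy cX
  have dY := h.differentiableAt_of_contDiffOn hy cY
  have dYY := h.differentiableAt_of_contDiffOn hy (h.contDiffOn_covDeriv cY cY)
  have dXY := h.differentiableAt_of_contDiffOn hy (h.contDiffOn_covDeriv cX cY)
  have dB := h.differentiableAt_of_contDiffOn hy (h.contDiffOn_lieBracket cY cX)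
  rw [h.curv_eq hy cX cY cY]
  simp only [map_sub, sub_apply]
  have h1 := h.fderiv_metric hy dYY dX (X y)
  -- ⟨∇_X ∇_Y Y, X⟩ comes from differentiating ⟨∇_Y Y, X⟩ = ⟨[Y, X], Y⟩ along the Killing field `X`,
  -- which produces only brackets.
  have h2 : fderiv ℝ (fun z => B z (covDeriv Γ Y z (Y z)) (X z)) y =
      fderiv ℝ (fun z => B z (VectorField.lieBracket ℝ Y X z) (Y z)) y := by
    apply Filter.EventuallyEq.fderiv_eq
    filter_upwards [hT] with z hz using h.metric_covDeriv_self hX hY hz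
  rw [h2, h.fderiv_metric_killing hX hy dB dY] at h1
  have h3 := h.fderiv_metric hy dXY dX (Y y)
  -- ⟨∇_X Y, X⟩ is identically zero because ∇Y is skew; its derivative along `Y` gives ⟨∇_Y ∇_X Y,
  -- X⟩ = -⟨∇_X Y, ∇_Y X⟩.
  have h4 : fderiv ℝ (fun z => B z (covDeriv Γ Y z (X z)) (X z)) y = fderiv ℝ (fun _ => (0:ℝ)) y := by
    apply Filter.EventuallyEq.fderiv_eq
    filter_upwards [hT] with z hz
    have := h.killing_skew hY hz (X z) (X z)
    rw [h.symm z hz (X z)] at this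
    linarith
  rw [h4, fderiv_fun_const] at h3
  have h5 := h.killing_skew hY hy (VectorField.lieBracket ℝ X Y y) (X y)
  have h6 : VectorField.lieBracket ℝ X Y y = - VectorField.lieBracket ℝ Y X y :=
    VectorField.lieBracket_swap
  have h7 : covDeriv Γ X y (Y y) = covDeriv Γ Y y (X y) + VectorField.lieBracket ℝ Y X y := by
    rw [h.lieBracket_eq hy]; abel
  rw [h7] at h3
  rw [h6] at h1 h5 ⊢
  have h8 := h.symm y hy (VectorField.lieBracket ℝ Y X y) (covDeriv Γ Y y (X y))
  simp only [map_neg, map_add, neg_apply, Pi.zero_apply,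
    zero_apply, covDeriv, add_apply] at *
  linarith

end IsLeviCivitaOn

end LocalGeometry

/-! ### The metric coefficients and the Christoffel symbols in a chart. -/

namespace RiemMetric

section

variable {E : Type*} [NormedAddCommGroup E] [NormedSpace ℝ E] [FiniteDimensional ℝ E]
  {M : Type*} [TopologicalSpace M] [ChartedSpace E M] [IsManifold 𝓘(ℝ, E) ∞ M]
  (g : RiemMetric E M)

instance instIsManifoldOne : IsManifold 𝓘(ℝ, E) 1 M := IsManifold.of_le (n := ∞) (by simp)

theorem contMDiffAt_extChartAt_symm {x₀ : M} {y : E} (hy : y ∈ (extChartAt 𝓘(ℝ, E) x₀).target) :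
    ContMDiffAt 𝓘(ℝ, E) 𝓘(ℝ, E) ∞ (extChartAt 𝓘(ℝ, E) x₀).symm y :=
  (contMDiffOn_extChartAt_symm x₀).contMDiffAt ((isOpen_extChartAt_target (I := 𝓘(ℝ, E)) x₀).mem_nhds hy)

theorem symm_mem_source {x₀ : M} {y : E} (hy : y ∈ (extChartAt 𝓘(ℝ, E) x₀).target) :
    (extChartAt 𝓘(ℝ, E) x₀).symm y ∈ (chartAt E x₀).source := by
  have := (extChartAt 𝓘(ℝ, E) x₀).map_target hy
  rwa [extChartAt_source] at this

theorem symmL_eq_chartFrame {x₀ : M} {y : E} (hy : y ∈ (extChartAt 𝓘(ℝ, E) x₀).target) :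
    (trivializationAt E (TangentSpace 𝓘(ℝ, E)) x₀).symmL ℝ ((extChartAt 𝓘(ℝ, E) x₀).symm y) =
      chartFrame x₀ y := by
  rw [TangentBundle.symmL_trivializationAt (symm_mem_source hy), chartFrame]
  rw [(extChartAt 𝓘(ℝ, E) x₀).right_inv hy]
  rw [modelWithCornersSelf_coe, range_id, mfderivWithin_univ]

theorem mfderiv_extChartAt_chartFrame {x₀ : M} {y : E}
    (hy : y ∈ (extChartAt 𝓘(ℝ, E) x₀).target) (u : E) :
    mfderiv 𝓘(ℝ, E) 𝓘(ℝ, E) (extChartAt 𝓘(ℝ, E) x₀) ((extChartAt 𝓘(ℝ, E) x₀).symm y)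
      (chartFrame x₀ y u) = u := by
  have h := mfderiv_extChartAt_comp_mfderivWithin_extChartAt_symm (I := 𝓘(ℝ, E)) hy
  rw [modelWithCornersSelf_coe, range_id, mfderivWithin_univ] at h
  exact DFunLike.congr_fun h u

theorem chartFrame_mfderiv_extChartAt {x₀ : M} {y : E}
    (hy : y ∈ (extChartAt 𝓘(ℝ, E) x₀).target)
    (v : TangentSpace 𝓘(ℝ, E) ((extChartAt 𝓘(ℝ, E) x₀).symm y)) :
    chartFrame x₀ y (mfderiv 𝓘(ℝ, E) 𝓘(ℝ, E) (extChartAt 𝓘(ℝ, E) x₀)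
      ((extChartAt 𝓘(ℝ, E) x₀).symm y) v) = v := by
  have h := mfderivWithin_extChartAt_symm_comp_mfderiv_extChartAt (I := 𝓘(ℝ, E)) hy
  rw [modelWithCornersSelf_coe, range_id, mfderivWithin_univ] at h
  exact DFunLike.congr_fun h v

theorem coord_symm (x₀ : M) (y u v : E) : g.coord x₀ y u v = g.coord x₀ y v u := by
  rw [coord_apply, coord_apply]; exact g.symm _ _ _

theorem coord_pos {x₀ : M} {y : E} (hy : y ∈ (extChartAt 𝓘(ℝ, E) x₀).target) {u : E}
    (hu : u ≠ 0) : 0 < g.coord x₀ y u u := by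
  rw [coord_apply]
  refine g.pos _ _ fun h => hu ?_
  rw [← mfderiv_extChartAt_chartFrame hy u, h]
  exact map_zero _

theorem contDiffOn_coord (x₀ : M) : ContDiffOn ℝ ∞ (g.coord x₀) (extChartAt 𝓘(ℝ, E) x₀).target := by
  refine contDiffOn_clm_apply.2 fun u => contDiffOn_clm_apply.2 fun v => ?_
  intro y hy
  apply ContDiffAt.contDiffWithinAt
  rw [← contMDiffAt_iff_contDiffAt]
  have hT := (isOpen_extChartAt_target (I := 𝓘(ℝ, E)) x₀).mem_nhds hy
  set φ := extChartAt 𝓘(ℝ, E) x₀ with hφ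
  -- In the trivialization of the tangent bundle at `x₀` the coordinate field of `w` is constant,
  -- hence it is a smooth section.
  have hs : ∀ w : E, ContMDiffAt 𝓘(ℝ, E) (𝓘(ℝ, E).prod 𝓘(ℝ, E)) ∞
      (fun z : E => (Bundle.TotalSpace.mk' E (φ.symm z) (chartFrame x₀ z w) :
        TangentBundle 𝓘(ℝ, E) M)) y := by
    intro w
    set e := trivializationAt E (TangentSpace 𝓘(ℝ, E) : M → Type _) x₀
    have hb : ∀ z ∈ φ.target, φ.symm z ∈ e.baseSet := fun z hz => by
      rw [TangentBundle.trivializationAt_baseSet (I := 𝓘(ℝ, E))]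
      exact symm_mem_source hz
    have h1 : ContMDiffAt 𝓘(ℝ, E) (𝓘(ℝ, E).prod 𝓘(ℝ, E)) ∞
        (fun z : E => (φ.symm z, w)) y := (contMDiffAt_extChartAt_symm hy).prodMk contMDiffAt_const
    have h2 : ContMDiffAt (𝓘(ℝ, E).prod 𝓘(ℝ, E)) (𝓘(ℝ, E).prod 𝓘(ℝ, E)) ∞
        e.toOpenPartialHomeomorph.symm (φ.symm y, w) := by
      refine e.contMDiffOn_symm.contMDiffAt (e.open_target.mem_nhds ?_)
      rw [e.target_eq]
      exact ⟨hb y hy, mem_univ _⟩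
    refine (h2.comp y h1).congr_of_eventuallyEq ?_
    filter_upwards [hT] with z hz
    rw [← symmL_eq_chartFrame hz]
    refine Eq.trans (congrArg _ ?_) (e.mk_symm (b := φ.symm z) (hb z hz) w)
    rw [Bundle.Trivialization.symmL_apply]
    exact hb z hz
  have := ContMDiffAt.clm_bundle_apply₂ (F₁ := E) (F₂ := E) (F₃ := ℝ)
    (E₃ := Bundle.Trivial M ℝ)
    (ψ := fun z : E => g.inner (φ.symm z))
    ((g.contMDiff _).comp y (contMDiffAt_extChartAt_symm hy)) (hs u) (hs v)
  rw [Bundle.contMDiffAt_totalSpace] at this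
  exact this.2

theorem coord_isInvertible {x₀ : M} {y : E} (hy : y ∈ (extChartAt 𝓘(ℝ, E) x₀).target) :
    (g.coord x₀ y).IsInvertible := by
  have hinj : Function.Injective (g.coord x₀ y) := by
    rw [injective_iff_map_eq_zero]
    intro u hu
    by_contra h
    have := g.coord_pos hy h
    rw [hu] at this
    simp at this
  have hd : Module.finrank ℝ E = Module.finrank ℝ (E →L[ℝ] ℝ) := by
    rw [← LinearMap.toContinuousLinearMap.finrank_eq]
    exact (Subspace.dual_finrank_eq (K := ℝ) (V := E)).symm
  refine ⟨(LinearEquiv.ofInjectiveOfFinrankEq (g.coord x₀ y).toLinearMap hinj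
    hd).toContinuousLinearEquiv, ?_⟩
  ext u; rfl

theorem coord_christoffel {x₀ : M} {y : E} (hy : y ∈ (extChartAt 𝓘(ℝ, E) x₀).target) (u v w : E) :
    g.coord x₀ y (g.christoffel x₀ y u v) w = (1 / 2 : ℝ) * g.koszul x₀ y u v w := by
  rw [christoffel_apply, map_smul]
  have h := (g.coord_isInvertible hy).self_apply_inverse (g.koszul x₀ y u v)
  rw [h]
  rfl

theorem contDiffOn_christoffel (x₀ : M) :
    ContDiffOn ℝ ∞ (g.christoffel x₀) (extChartAt 𝓘(ℝ, E) x₀).target := by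
  set T := (extChartAt 𝓘(ℝ, E) x₀).target
  have hD : ContDiffOn ℝ ∞ (fderiv ℝ (g.coord x₀)) T :=
    (g.contDiffOn_coord x₀).fderiv_of_isOpen (isOpen_extChartAt_target (I := 𝓘(ℝ, E)) x₀) (by simp)
  have hDa : ∀ u v w, ContDiffOn ℝ ∞ (fun y => fderiv ℝ (g.coord x₀) y u v w) T := fun u v w =>
    ((hD.clm_apply contDiffOn_const).clm_apply contDiffOn_const).clm_apply contDiffOn_const
  have hK : ContDiffOn ℝ ∞ (g.koszul x₀) T := by
    refine contDiffOn_clm_apply.2 fun u => contDiffOn_clm_apply.2 fun v =>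
      contDiffOn_clm_apply.2 fun w => ?_
    simp only [koszul_apply]
    exact ((hDa u v w).add (hDa v u w)).sub (hDa w u v)
  refine contDiffOn_clm_apply.2 fun u => contDiffOn_clm_apply.2 fun v => ?_
  simp only [christoffel_apply]
  refine contDiffOn_const.smul (ContDiffOn.clm_apply ?_ ((hK.clm_apply contDiffOn_const).clm_apply
    contDiffOn_const))
  intro y hy
  have : CompleteSpace E := FiniteDimensional.complete ℝ E
  exact ((g.coord_isInvertible hy).contDiffAt_map_inverse).comp_contDiffWithinAt y
    (g.contDiffOn_coord x₀ y hy)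

theorem fderiv_coord_symm {x₀ : M} {y : E} (hy : y ∈ (extChartAt 𝓘(ℝ, E) x₀).target) (u v w : E) :
    fderiv ℝ (g.coord x₀) y u v w = fderiv ℝ (g.coord x₀) y u w v := by
  have hB : DifferentiableAt ℝ (g.coord x₀) y :=
    ((g.contDiffOn_coord x₀).contDiffAt
      ((isOpen_extChartAt_target (I := 𝓘(ℝ, E)) x₀).mem_nhds hy)).differentiableAt (by simp)
  have h : ∀ v w, HasFDerivAt (fun z => g.coord x₀ z v w)
      (((fderiv ℝ (g.coord x₀) y).flip v).flip w) y := by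
    intro v w
    have := (hB.hasFDerivAt.clm_apply (hasFDerivAt_const v y)).clm_apply (hasFDerivAt_const w y)
    refine this.congr_fderiv ?_
    ext u
    simp
  have h1 := h v w
  simp only [g.coord_symm x₀ _ v w] at h1
  exact DFunLike.congr_fun (h1.unique (h w v)) u

theorem isLeviCivitaOn (x₀ : M) :
    IsLeviCivitaOn (g.coord x₀) (g.christoffel x₀) (extChartAt 𝓘(ℝ, E) x₀).target where
  isOpen := isOpen_extChartAt_target (I := 𝓘(ℝ, E)) x₀
  contDiffOn_metric := g.contDiffOn_coord x₀
  contDiffOn_connection := g.contDiffOn_christoffel x₀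
  symm _ _ := g.coord_symm x₀ _
  pos _ hy _ := g.coord_pos hy
  torsion_free y hy u v := by
    rw [christoffel_apply, christoffel_apply]
    congr 2
    ext w
    rw [koszul_apply, koszul_apply, g.fderiv_coord_symm hy w u v]
    ring
  metric_compat y hy u v w := by
    rw [g.coord_symm x₀ y v, g.coord_christoffel hy, g.coord_christoffel hy, koszul_apply,
      koszul_apply, g.fderiv_coord_symm hy u w v, g.fderiv_coord_symm hy v u w,
      g.fderiv_coord_symm hy w u v]
    ring

end

end RiemMetric

/-! ### Infinitesimal generators of a local group action. -/

section LocalAction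

variable {E F : Type*} [NormedAddCommGroup E] [NormedSpace ℝ E]
  [NormedAddCommGroup F] [NormedSpace ℝ F]

/-- For a smooth local action `Φ` of a local Lie group, the vector fields generated by right
differentiation bracket to minus the bracket of left-invariant fields. -/
theorem lieBracket_fundamental {m : F × F → F} {Φ : F × E → E} {e : F} {y : E}
    (hm : ContDiffAt ℝ 2 m (e, e)) (hΦ : ContDiffAt ℝ 2 Φ (e, y))
    (hm1 : ∀ᶠ q in 𝓝 e, m (e, q) = q) (hm2 : ∀ᶠ p in 𝓝 e, m (p, e) = p)
    (hΦ1 : Φ (e, y) = y)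
    (hmul : ∀ᶠ q in 𝓝 e, ∀ᶠ p in 𝓝 e, Φ (m (p, q), y) = Φ (p, Φ (q, y))) (X Y : F) :
    VectorField.lieBracket ℝ (fun z => fderiv ℝ Φ (e, z) (X, 0))
      (fun z => fderiv ℝ Φ (e, z) (Y, 0)) y =
    - fderiv ℝ Φ (e, y) (VectorField.lieBracket ℝ (fun p => fderiv ℝ m (p, e) (0, X))
      (fun p => fderiv ℝ m (p, e) (0, Y)) e, 0) := by
  have dm : ∀ᶠ w in 𝓝 (e, e), DifferentiableAt ℝ m w :=
    (hm.eventually (by simp)).mono fun w hw => hw.differentiableAt (by simp)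
  have dΦ : ∀ᶠ w in 𝓝 (e, y), DifferentiableAt ℝ Φ w :=
    (hΦ.eventually (by simp)).mono fun w hw => hw.differentiableAt (by simp)
  have d2m : DifferentiableAt ℝ (fderiv ℝ m) (e, e) :=
    (hm.fderiv_right (m := 1) (by norm_num)).differentiableAt (by simp)
  have d2Φ : DifferentiableAt ℝ (fderiv ℝ Φ) (e, y) :=
    (hΦ.fderiv_right (m := 1) (by norm_num)).differentiableAt (by simp)
  have sm := (hm.isSymmSndFDerivAt (by simp)).eq
  have sΦ := (hΦ.isSymmSndFDerivAt (by simp)).eq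
  -- derivatives of the fundamental fields and of the left-invariant fields
  have hξ : ∀ (X : F) v, fderiv ℝ (fun z => fderiv ℝ Φ (e, z) (X, 0)) y v =
      fderiv ℝ (fderiv ℝ Φ) (e, y) (0, v) (X, 0) := by
    intro X v
    have h1 := (d2Φ.hasFDerivAt.comp y (hasFDerivAt_prodMk_right e y)).clm_apply
      (hasFDerivAt_const ((X, 0) : F × E) y)
    have h2 : fderiv ℝ (fun z => fderiv ℝ Φ (e, z) (X, 0)) y = _ := h1.fderiv
    rw [h2]; simp
  have hL : ∀ (X : F) v, fderiv ℝ (fun p => fderiv ℝ m (p, e) (0, X)) e v =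
      fderiv ℝ (fderiv ℝ m) (e, e) (v, 0) (0, X) := by
    intro X v
    have h1 := (HasFDerivAt.comp (g := fderiv ℝ m) (f := fun p => (p, e)) e d2m.hasFDerivAt
      (hasFDerivAt_prodMk_left e e)).clm_apply
      (hasFDerivAt_const ((0, X) : F × F) e)
    have h2 : fderiv ℝ (fun p => fderiv ℝ m (p, e) (0, X)) e = _ := h1.fderiv
    rw [h2]; simp
  have hme : m (e, e) = e := hm1.self_of_nhds
  have hmX1 : ∀ X : F, fderiv ℝ m (e, e) (0, X) = X := by
    intro X
    have h1 := dm.self_of_nhds.hasFDerivAt.comp e (hasFDerivAt_prodMk_right e e)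
    have h2 : HasFDerivAt (fun q => m (e, q)) (ContinuousLinearMap.id ℝ F) e :=
      (hasFDerivAt_id e).congr_of_eventuallyEq hm1
    simpa using DFunLike.congr_fun (h1.unique h2) X
  have hmX2 : ∀ X : F, fderiv ℝ m (e, e) (X, 0) = X := by
    intro X
    have h1 := HasFDerivAt.comp (g := m) (f := fun p => (p, e)) e dm.self_of_nhds.hasFDerivAt
      (hasFDerivAt_prodMk_left e e)
    have h2 : HasFDerivAt (fun q => m (q, e)) (ContinuousLinearMap.id ℝ F) e :=
      (hasFDerivAt_id e).congr_of_eventuallyEq hm2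
    simpa using DFunLike.congr_fun (h1.unique h2) X
  have cΦ : Tendsto (fun q => Φ (q, y)) (𝓝 e) (𝓝 y) := by
    have := hΦ.continuousAt.comp (f := fun q => (q, y)) (x := e) (by fun_prop)
    simpa [ContinuousAt, hΦ1, Function.comp_def] using this
  -- The action law differentiated in `p` at `e` with `q` fixed; this is why the neighbourhood of
  -- `p` in `hmul` may depend on `q`.
  have key : ∀ X : F, ∀ᶠ q in 𝓝 e, fderiv ℝ Φ (q, y) (fderiv ℝ m (e, q) (X, 0), 0) =
      fderiv ℝ Φ (e, Φ (q, y)) (X, 0) := by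
    intro X
    have t1 : Tendsto (fun q : F => (e, q)) (𝓝 e) (𝓝 (e, e)) :=
      (Continuous.prodMk_right e).tendsto e
    have t2 : Tendsto (fun q : F => (q, y)) (𝓝 e) (𝓝 (e, y)) :=
      (Continuous.prodMk_left y).tendsto e
    have t3 : Tendsto (fun q : F => (e, Φ (q, y))) (𝓝 e) (𝓝 (e, y)) :=
      tendsto_const_nhds.prodMk_nhds cΦ
    filter_upwards [t1.eventually dm, t2.eventually dΦ, t3.eventually dΦ, hmul, hm1]
      with q h1 h2 h3 h4 h5
    have k1 : HasFDerivAt (fun p => m (p, q)) _ e :=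
      HasFDerivAt.comp (g := m) e h1.hasFDerivAt (hasFDerivAt_prodMk_left e q)
    have k2 : HasFDerivAt (fun p => Φ (m (p, q), y)) _ e :=
      HasFDerivAt.comp (g := Φ) (f := fun p => (m (p, q), y)) e
        (by rw [h5]; exact h2.hasFDerivAt) (k1.prodMk (hasFDerivAt_const y e))
    have k3 : HasFDerivAt (fun p => Φ (p, Φ (q, y))) _ e :=
      HasFDerivAt.comp (g := Φ) e h3.hasFDerivAt (hasFDerivAt_prodMk_left e (Φ (q, y)))
    have := DFunLike.congr_fun (k2.unique (k3.congr_of_eventuallyEq h4)) X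
    simpa using this
  -- `key` differentiated in `q` at `e`. Exchanging `X` and `Y` and subtracting removes the
  -- symmetric second derivative of `Φ` and leaves the antisymmetrized mixed derivative of `m`,
  -- which is the bracket.
  have main : ∀ X Y : F, fderiv ℝ (fderiv ℝ Φ) (e, y) (Y, 0) (X, 0) +
      fderiv ℝ Φ (e, y) (fderiv ℝ (fderiv ℝ m) (e, e) (0, Y) (X, 0), 0) =
      fderiv ℝ (fderiv ℝ Φ) (e, y) (0, fderiv ℝ Φ (e, y) (Y, 0)) (X, 0) := by
    intro X Y
    have k1 : HasFDerivAt (fun q => fderiv ℝ m (e, q) (X, 0)) _ e :=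
      (HasFDerivAt.comp (g := fderiv ℝ m) e d2m.hasFDerivAt
      (hasFDerivAt_prodMk_right e e)).clm_apply (hasFDerivAt_const ((X, 0) : F × F) e)
    have k2 : HasFDerivAt (fun q => fderiv ℝ Φ (q, y) (fderiv ℝ m (e, q) (X, 0), 0)) _ e :=
      (HasFDerivAt.comp (g := fderiv ℝ Φ) e d2Φ.hasFDerivAt
      (hasFDerivAt_prodMk_left e y)).clm_apply (k1.prodMk (hasFDerivAt_const (0 : E) e))
    have k3 : HasFDerivAt (fun q => Φ (q, y)) _ e :=
      HasFDerivAt.comp (g := Φ) e dΦ.self_of_nhds.hasFDerivAt (hasFDerivAt_prodMk_left e y)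
    have k4 : HasFDerivAt (fun q => fderiv ℝ Φ (e, Φ (q, y)) (X, 0)) _ e :=
      (HasFDerivAt.comp (g := fderiv ℝ Φ) (f := fun q => (e, Φ (q, y))) e
      (by rw [hΦ1]; exact d2Φ.hasFDerivAt) ((hasFDerivAt_const e e).prodMk k3)).clm_apply
        (hasFDerivAt_const ((X, 0) : F × E) e)
    have := DFunLike.congr_fun (k2.unique (k4.congr_of_eventuallyEq (key X))) Y
    simp [hmX2] at this
    rw [← this]; abel
  have split : ∀ a b : F, fderiv ℝ Φ (e, y) (a - b, 0) =
      fderiv ℝ Φ (e, y) (a, 0) - fderiv ℝ Φ (e, y) (b, 0) := by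
    intro a b
    rw [← map_sub]; simp
  simp only [VectorField.lieBracket, hξ, hL, hmX1, split]
  rw [← main X Y, ← main Y X, sΦ (X, 0) (Y, 0), sm (0, X), sm (0, Y)]
  abel

/-- Killing's equation is the derivative in `p` at `e` of the isometry identity; symmetry of the
mixed derivatives of `Φ` turns ∂_p ∂_y Φ into the derivative of the generating field. -/
theorem isKilling_fundamental {B : E → E →L[ℝ] E →L[ℝ] ℝ} {Φ : F × E → E} {e : F} {y : E}
    (hB : DifferentiableAt ℝ B y) (hΦ : ContDiffAt ℝ 2 Φ (e, y)) (hΦ1 : ∀ᶠ z in 𝓝 y, Φ (e, z) = z)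
    (hiso : ∀ᶠ p in 𝓝 e, ∀ u v, B (Φ (p, y)) (fderiv ℝ Φ (p, y) (0, u)) (fderiv ℝ Φ (p, y) (0, v))
      = B y u v) (X : F) (u v : E) :
    fderiv ℝ B y (fderiv ℝ Φ (e, y) (X, 0)) u v
      + B y (fderiv ℝ (fun z => fderiv ℝ Φ (e, z) (X, 0)) y u) v
      + B y u (fderiv ℝ (fun z => fderiv ℝ Φ (e, z) (X, 0)) y v) = 0 := by
  have dΦ : DifferentiableAt ℝ Φ (e, y) := hΦ.differentiableAt (by simp)
  have d2Φ : DifferentiableAt ℝ (fderiv ℝ Φ) (e, y) :=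
    (hΦ.fderiv_right (m := 1) (by norm_num)).differentiableAt (by simp)
  have sΦ := (hΦ.isSymmSndFDerivAt (by simp)).eq
  have hξ : ∀ v, fderiv ℝ (fun z => fderiv ℝ Φ (e, z) (X, 0)) y v =
      fderiv ℝ (fderiv ℝ Φ) (e, y) (X, 0) (0, v) := by
    intro v
    have h1 := (d2Φ.hasFDerivAt.comp y (hasFDerivAt_prodMk_right e y)).clm_apply
      (hasFDerivAt_const ((X, 0) : F × E) y)
    have h2 : fderiv ℝ (fun z => fderiv ℝ Φ (e, z) (X, 0)) y = _ := h1.fderiv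
    rw [h2, ← sΦ]; simp
  have hid : ∀ u : E, fderiv ℝ Φ (e, y) (0, u) = u := by
    intro u
    have h1 := dΦ.hasFDerivAt.comp y (hasFDerivAt_prodMk_right e y)
    have h2 : HasFDerivAt (fun q => Φ (e, q)) (ContinuousLinearMap.id ℝ E) y :=
      (hasFDerivAt_id y).congr_of_eventuallyEq hΦ1
    simpa using DFunLike.congr_fun (h1.unique h2) u
  have hy := hΦ1.self_of_nhds
  have k0 : HasFDerivAt (fun q => Φ (q, y)) _ e :=
    HasFDerivAt.comp (g := Φ) e dΦ.hasFDerivAt (hasFDerivAt_prodMk_left e y)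
  have k1 : HasFDerivAt (fun q => B (Φ (q, y))) _ e :=
    HasFDerivAt.comp (g := B) (f := fun q => Φ (q, y)) e (by rw [hy]; exact hB.hasFDerivAt) k0
  have k2 : ∀ u : E, HasFDerivAt (fun q => fderiv ℝ Φ (q, y) (0, u)) _ e := fun u =>
    (HasFDerivAt.comp (g := fderiv ℝ Φ) e d2Φ.hasFDerivAt
      (hasFDerivAt_prodMk_left e y)).clm_apply (hasFDerivAt_const ((0, u) : F × E) e)
  have k3 := (k1.clm_apply (k2 u)).clm_apply (k2 v)
  have k4 := (hasFDerivAt_const (𝕜 := ℝ) (B y u v) e).congr_of_eventuallyEq (hiso.mono fun p hp => hp u v)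
  have := DFunLike.congr_fun (k3.unique k4) X
  simp [hy, hid] at this
  rw [hξ, hξ]
  linarith

end LocalAction

/-! ### Smooth Lie group actions in charts. -/

section ChartAction

variable {F : Type*} [NormedAddCommGroup F] [NormedSpace ℝ F]
  {G : Type*} [TopologicalSpace G] [ChartedSpace F G] [Group G]
  {E : Type*} [NormedAddCommGroup E] [NormedSpace ℝ E]
  {M : Type*} [TopologicalSpace M] [ChartedSpace E M]

/-- The action `(a, x) ↦ a • x` read in the chart of `G` at `1` and the chart of `M` at `x₀`. -/
def actChart (F : Type*) [NormedAddCommGroup F] [NormedSpace ℝ F]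
    (G : Type*) [TopologicalSpace G] [ChartedSpace F G] [Group G]
    {E : Type*} [NormedAddCommGroup E] [NormedSpace ℝ E]
    {M : Type*} [TopologicalSpace M] [ChartedSpace E M] [MulAction G M] (x₀ : M) (p : F × E) : E :=
  extChartAt 𝓘(ℝ, E) x₀
    ((extChartAt 𝓘(ℝ, F) (1 : G)).symm p.1 • (extChartAt 𝓘(ℝ, E) x₀).symm p.2)

/-- The vector field generated by an element of the Lie algebra of `G`, in the chart at `x₀`. -/
def fundField (F : Type*) [NormedAddCommGroup F] [NormedSpace ℝ F]
    (G : Type*) [TopologicalSpace G] [ChartedSpace F G] [Group G]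
    {E : Type*} [NormedAddCommGroup E] [NormedSpace ℝ E]
    {M : Type*} [TopologicalSpace M] [ChartedSpace E M] [MulAction G M] (x₀ : M)
    (X : GroupLieAlgebra 𝓘(ℝ, F) G) (z : E) : E :=
  fderiv ℝ (actChart F G x₀) (extChartAt 𝓘(ℝ, F) (1 : G) 1, z) ((X : F), (0 : E))

local notation "ψ" => extChartAt 𝓘(ℝ, F) (1 : G)

/-- The derivative at `1` of a map into `M`, in charts. -/
theorem fderiv_chart_comp [IsManifold 𝓘(ℝ, F) ∞ G] [IsManifold 𝓘(ℝ, E) ∞ M] {x₀ : M} {f : G → M}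
    (hf : MDifferentiableAt 𝓘(ℝ, F) 𝓘(ℝ, E) f 1) (h : f 1 ∈ (chartAt E x₀).source)
    (X : GroupLieAlgebra 𝓘(ℝ, F) G) :
    fderiv ℝ (fun p => extChartAt 𝓘(ℝ, E) x₀ (f ((ψ).symm p))) (ψ 1) (X : F) =
      mfderiv 𝓘(ℝ, E) 𝓘(ℝ, E) (extChartAt 𝓘(ℝ, E) x₀) (f 1)
        (mfderiv 𝓘(ℝ, F) 𝓘(ℝ, E) f 1 X) := by
  have : IsManifold 𝓘(ℝ, F) 1 G := IsManifold.of_le (n := ∞) (by simp)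
  have : IsManifold 𝓘(ℝ, E) 1 M := IsManifold.of_le (n := ∞) (by simp)
  have h1 : MDifferentiableAt 𝓘(ℝ, F) 𝓘(ℝ, F) (ψ).symm (ψ 1) :=
    ((contMDiffOn_extChartAt_symm (n := 1) (1 : G)).contMDiffAt
      ((isOpen_extChartAt_target (1 : G)).mem_nhds (mem_extChartAt_target _))).mdifferentiableAt
      (by simp)
  have h2 : MDifferentiableAt 𝓘(ℝ, E) 𝓘(ℝ, E) (extChartAt 𝓘(ℝ, E) x₀) (f 1) :=
    mdifferentiableAt_extChartAt h
  have e1 : (ψ).symm (ψ 1) = 1 := extChartAt_to_inv (1 : G)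
  -- The tangent space at `1` is identified with the model space by this very chart, so its
  -- derivative there is the identity.
  have h3 : HasMFDerivAt 𝓘(ℝ, F) 𝓘(ℝ, F) (ψ).symm (ψ 1) (ContinuousLinearMap.id ℝ F) := by
    have := h1.hasMFDerivAt
    have h4 := mfderivWithin_range_extChartAt_symm (I := 𝓘(ℝ, F)) (x := (1 : G))
    rw [modelWithCornersSelf_coe, range_id, mfderivWithin_univ] at h4
    rwa [h4] at this
  have h5 : HasMFDerivAt 𝓘(ℝ, F) 𝓘(ℝ, E) f ((ψ).symm (ψ 1)) (mfderiv 𝓘(ℝ, F) 𝓘(ℝ, E) f 1) := by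
    rw [e1]; exact hf.hasMFDerivAt
  have h6 : HasMFDerivAt 𝓘(ℝ, E) 𝓘(ℝ, E) (extChartAt 𝓘(ℝ, E) x₀) (f ((ψ).symm (ψ 1)))
      (mfderiv 𝓘(ℝ, E) 𝓘(ℝ, E) (extChartAt 𝓘(ℝ, E) x₀) (f 1)) := by
    rw [e1]; exact h2.hasMFDerivAt
  let A₁ : E →L[ℝ] E := mfderiv 𝓘(ℝ, E) 𝓘(ℝ, E) (extChartAt 𝓘(ℝ, E) x₀) (f 1)
  let A₂ : F →L[ℝ] E := mfderiv 𝓘(ℝ, F) 𝓘(ℝ, E) f 1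
  have h7 : HasFDerivAt (fun p => extChartAt 𝓘(ℝ, E) x₀ (f ((ψ).symm p)))
      (A₁.comp (A₂.comp (ContinuousLinearMap.id ℝ F))) (ψ 1) :=
    (h6.comp (ψ 1) (h5.comp (ψ 1) h3)).hasFDerivAt
  exact DFunLike.congr_fun h7.fderiv X

variable [MulAction G M]

theorem contDiffAt_actChart [IsManifold 𝓘(ℝ, F) ∞ G] [IsManifold 𝓘(ℝ, E) ∞ M]
    [ContMDiffSMul 𝓘(ℝ, F) 𝓘(ℝ, E) ∞ G M] {x₀ : M} {p : F} {z : E} (hp : p ∈ (ψ).target)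
    (hz : z ∈ (extChartAt 𝓘(ℝ, E) x₀).target)
    (h : (ψ).symm p • (extChartAt 𝓘(ℝ, E) x₀).symm z ∈ (chartAt E x₀).source) :
    ContDiffAt ℝ ∞ (actChart F G x₀) (p, z) := by
  rw [← contMDiffAt_iff_contDiffAt]
  have h1 : ContMDiffAt 𝓘(ℝ, F × E) 𝓘(ℝ, F) ∞ (fun w : F × E => (ψ).symm w.1) (p, z) :=
    ((contMDiffOn_extChartAt_symm (1 : G)).contMDiffAt
      ((isOpen_extChartAt_target (1 : G)).mem_nhds hp)).comp (p, z)
      (contDiff_fst.contMDiff.contMDiffAt)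
  have h2 : ContMDiffAt 𝓘(ℝ, F × E) 𝓘(ℝ, E) ∞
      (fun w : F × E => (extChartAt 𝓘(ℝ, E) x₀).symm w.2) (p, z) :=
    ((contMDiffOn_extChartAt_symm x₀).contMDiffAt
      ((isOpen_extChartAt_target x₀).mem_nhds hz)).comp (p, z)
      (contDiff_snd.contMDiff.contMDiffAt)
  exact (contMDiffAt_extChartAt' h).comp (p, z) (h1.smul h2)

theorem one_mem_target : ψ 1 ∈ (ψ).target := mem_extChartAt_target _

theorem symm_one : (ψ).symm (ψ 1) = 1 := extChartAt_to_inv (1 : G)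

theorem symm_target_mem_source {x₀ : M} {z : E} (hz : z ∈ (extChartAt 𝓘(ℝ, E) x₀).target) :
    (extChartAt 𝓘(ℝ, E) x₀).symm z ∈ (chartAt E x₀).source := by
  have := (extChartAt 𝓘(ℝ, E) x₀).map_target hz
  rwa [extChartAt_source] at this

theorem contDiffAt_actChart_one [IsManifold 𝓘(ℝ, F) ∞ G] [IsManifold 𝓘(ℝ, E) ∞ M]
    [ContMDiffSMul 𝓘(ℝ, F) 𝓘(ℝ, E) ∞ G M] {x₀ : M} {z : E}
    (hz : z ∈ (extChartAt 𝓘(ℝ, E) x₀).target) :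
    ContDiffAt ℝ ∞ (actChart F G x₀) (ψ 1, z) := by
  refine contDiffAt_actChart one_mem_target hz ?_
  rw [symm_one, one_smul]
  exact symm_target_mem_source hz

theorem actChart_one {x₀ : M} {z : E} (hz : z ∈ (extChartAt 𝓘(ℝ, E) x₀).target) :
    actChart F G x₀ (ψ 1, z) = z := by
  rw [actChart, symm_one, one_smul, PartialEquiv.right_inv _ hz]

theorem contDiffOn_fundField [IsManifold 𝓘(ℝ, F) ∞ G] [IsManifold 𝓘(ℝ, E) ∞ M]
    [ContMDiffSMul 𝓘(ℝ, F) 𝓘(ℝ, E) ∞ G M] (x₀ : M) (X : GroupLieAlgebra 𝓘(ℝ, F) G) :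
    ContDiffOn ℝ ∞ (fundField F G x₀ X) (extChartAt 𝓘(ℝ, E) x₀).target := by
  intro z hz
  apply ContDiffAt.contDiffWithinAt
  have h1 := (contDiffAt_actChart_one (F := F) (G := G) hz).fderiv_right (m := ∞) (by simp)
  have h2 : ContDiffAt ℝ ∞ (fun w : E => ((ψ 1 : F), w)) z := contDiffAt_const.prodMk contDiffAt_id
  exact (h1.comp z h2).clm_apply contDiffAt_const

theorem tendsto_symm_one : Tendsto (ψ).symm (𝓝 (ψ 1)) (𝓝 1) := by
  have := (continuousAt_extChartAt_symm (I := 𝓘(ℝ, F)) (1 : G)).tendsto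
  rwa [extChartAt_to_inv (1 : G)] at this

theorem fundField_eq [IsManifold 𝓘(ℝ, F) ∞ G] [IsManifold 𝓘(ℝ, E) ∞ M]
    [ContMDiffSMul 𝓘(ℝ, F) 𝓘(ℝ, E) ∞ G M] {x₀ : M} {z : E}
    (hz : z ∈ (extChartAt 𝓘(ℝ, E) x₀).target) (X : GroupLieAlgebra 𝓘(ℝ, F) G) :
    fundField F G x₀ X z = mfderiv 𝓘(ℝ, E) 𝓘(ℝ, E) (extChartAt 𝓘(ℝ, E) x₀)
      ((1 : G) • (extChartAt 𝓘(ℝ, E) x₀).symm z)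
      (mfderiv 𝓘(ℝ, F) 𝓘(ℝ, E) (fun a : G => a • (extChartAt 𝓘(ℝ, E) x₀).symm z) 1 X) := by
  refine Eq.trans ?_ (fderiv_chart_comp
    (f := fun a : G => a • (extChartAt 𝓘(ℝ, E) x₀).symm z) ?_ ?_ X)
  · have h1 := ((contDiffAt_actChart_one (F := F) (G := G) hz).differentiableAt
      (by simp)).hasFDerivAt
    have h2 : HasFDerivAt (fun p => actChart F G x₀ (p, z)) _ (ψ 1) :=
      HasFDerivAt.comp (g := actChart F G x₀) (ψ 1) h1 (hasFDerivAt_prodMk_left (ψ 1) z)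
    exact (DFunLike.congr_fun h2.fderiv X).symm
  · have : ContMDiffAt 𝓘(ℝ, F) 𝓘(ℝ, E) ∞ (fun a : G => a • (extChartAt 𝓘(ℝ, E) x₀).symm z) 1 :=
      contMDiffAt_id.smul contMDiffAt_const
    exact this.mdifferentiableAt (by simp)
  · rw [one_smul]
    exact symm_target_mem_source hz

variable [LieGroup 𝓘(ℝ, F) ∞ G]

/-- Associativity survives in charts as long as `q • z` stays in the chart at `x₀` and `p q` in the
chart at `1`. The second condition is open in `p` once `q` is fixed. -/
theorem eventually_actChart_mul [IsManifold 𝓘(ℝ, E) ∞ M]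
    [ContMDiffSMul 𝓘(ℝ, F) 𝓘(ℝ, E) ∞ G M] {x₀ : M} {z : E}
    (hz : z ∈ (extChartAt 𝓘(ℝ, E) x₀).target) :
    ∀ᶠ q in 𝓝 (ψ 1), ∀ᶠ p in 𝓝 (ψ 1), actChart F G x₀ (actChart F G (1 : G) (p, q), z) =
      actChart F G x₀ (p, actChart F G x₀ (q, z)) := by
  have : ContinuousSMul G M := ContMDiffSMul.continuousSMul (I := 𝓘(ℝ, F)) (I' := 𝓘(ℝ, E)) ∞
  have : IsTopologicalGroup G := topologicalGroup_of_lieGroup 𝓘(ℝ, F) ∞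
  have h1 : ∀ᶠ q in 𝓝 (ψ 1), (ψ).symm q ∈ (ψ).source := by
    refine tendsto_symm_one.eventually ?_
    exact (isOpen_extChartAt_source (1 : G)).mem_nhds (mem_extChartAt_source _)
  have h2 : ∀ᶠ q in 𝓝 (ψ 1), (ψ).symm q • (extChartAt 𝓘(ℝ, E) x₀).symm z ∈
      (extChartAt 𝓘(ℝ, E) x₀).source := by
    have : Tendsto (fun q => (ψ).symm q • (extChartAt 𝓘(ℝ, E) x₀).symm z) (𝓝 (ψ 1))
        (𝓝 ((1 : G) • (extChartAt 𝓘(ℝ, E) x₀).symm z)) :=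
      tendsto_symm_one.smul tendsto_const_nhds
    rw [one_smul] at this
    exact this.eventually ((isOpen_extChartAt_source x₀).mem_nhds
      ((extChartAt 𝓘(ℝ, E) x₀).map_target hz))
  filter_upwards [h1, h2] with q hq1 hq2
  have h3 : ∀ᶠ p in 𝓝 (ψ 1), (ψ).symm p • (ψ).symm q ∈ (ψ).source := by
    have : Tendsto (fun p => (ψ).symm p • (ψ).symm q) (𝓝 (ψ 1)) (𝓝 ((1 : G) • (ψ).symm q)) :=
      tendsto_symm_one.smul tendsto_const_nhds
    rw [one_smul] at this
    exact this.eventually ((isOpen_extChartAt_source (1 : G)).mem_nhds hq1)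
  filter_upwards [h3] with p hp
  simp only [actChart]
  rw [(ψ).left_inv hp, PartialEquiv.left_inv _ hq2, smul_assoc]

/-- The bracket of the Lie algebra of `G`, in the chart at `1`. -/
theorem groupLieAlgebra_bracket_eq (X Y : GroupLieAlgebra 𝓘(ℝ, F) G) :
    ⁅X, Y⁆ = VectorField.lieBracket ℝ
      (fun p => fderiv ℝ (actChart F G (1 : G)) (p, ψ 1) ((0 : F), (X : F)))
      (fun p => fderiv ℝ (actChart F G (1 : G)) (p, ψ 1) ((0 : F), (Y : F))) (ψ 1) := by
  have : IsManifold 𝓘(ℝ, F) 1 G := IsManifold.of_le (n := ∞) (by simp)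
  -- The left-invariant field at `a` is the derivative at `1` of `b ↦ a * b`, hence in the chart the
  -- partial derivative of the multiplication in its second variable.
  have key : ∀ X : GroupLieAlgebra 𝓘(ℝ, F) G, ∀ᶠ p in 𝓝 (ψ 1),
      VectorField.mpullbackWithin 𝓘(ℝ, F) 𝓘(ℝ, F) (ψ).symm (mulInvariantVectorField X)
        (range 𝓘(ℝ, F)) p = fderiv ℝ (actChart F G (1 : G)) (p, ψ 1) ((0 : F), (X : F)) := by
    intro X
    filter_upwards [(isOpen_extChartAt_target (I := 𝓘(ℝ, F)) (1 : G)).mem_nhds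
      (mem_extChartAt_target _)] with p hp
    rw [VectorField.mpullbackWithin_apply, mulInvariantVectorField]
    have i1 : (mfderivWithin 𝓘(ℝ, F) 𝓘(ℝ, F) (ψ).symm (range 𝓘(ℝ, F)) p).inverse =
        mfderiv 𝓘(ℝ, F) 𝓘(ℝ, F) (ψ) ((ψ).symm p) :=
      ContinuousLinearMap.inverse_eq (mfderivWithin_extChartAt_symm_comp_mfderiv_extChartAt hp)
        (mfderiv_extChartAt_comp_mfderivWithin_extChartAt_symm hp)
    rw [i1]
    have hsrc : (ψ).symm p ∈ (chartAt F (1 : G)).source :=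
      symm_target_mem_source (E := F) hp
    have h0 := fderiv_chart_comp (F := F) (E := F) (x₀ := (1 : G)) (f := fun b : G => (ψ).symm p * b)
      ((contMDiff_mul_left (I := 𝓘(ℝ, F)) (n := ∞)).contMDiffAt.mdifferentiableAt (by simp))
      (by rwa [mul_one]) X
    have h1 := ((contDiffAt_actChart (F := F) (G := G) (x₀ := (1 : G)) hp (one_mem_target (F := F))
      (by rw [symm_one (F := F), smul_eq_mul, mul_one]; exact hsrc)).differentiableAt
      (by simp)).hasFDerivAt
    have h2 : HasFDerivAt (fun q => actChart F G (1 : G) (p, q)) _ (ψ 1) :=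
      HasFDerivAt.comp (g := actChart F G (1 : G)) (ψ 1) h1 (hasFDerivAt_prodMk_right p (ψ 1))
    have h4 : fderiv ℝ (actChart F G (1 : G)) (p, ψ 1) ((0 : F), (X : F)) =
        fderiv ℝ (fun q => actChart F G (1 : G) (p, q)) (ψ 1) (X : F) :=
      (DFunLike.congr_fun h2.fderiv X).symm
    rw [h4]
    refine Eq.trans ?_ h0.symm
    exact congrArg (fun a : G => (mfderiv 𝓘(ℝ, F) 𝓘(ℝ, F) (ψ) a : F →L[ℝ] F)
      ((mfderiv 𝓘(ℝ, F) 𝓘(ℝ, F) (fun b : G => (ψ).symm p * b) 1 : F →L[ℝ] F) (X : F)))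
      (mul_one _).symm
  have e1 : ((ψ).symm ⁻¹' univ ∩ range 𝓘(ℝ, F)) = univ := by
    rw [modelWithCornersSelf_coe, range_id, preimage_univ, univ_inter]
  have e2 : (mfderiv 𝓘(ℝ, F) 𝓘(ℝ, F) (ψ) 1 : F →L[ℝ] F) = ContinuousLinearMap.id ℝ F :=
    mfderiv_extChartAt_self
  let V : GroupLieAlgebra 𝓘(ℝ, F) G → F → F := fun X =>
    VectorField.mpullbackWithin 𝓘(ℝ, F) 𝓘(ℝ, F) (ψ).symm (mulInvariantVectorField X)
      (range 𝓘(ℝ, F))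
  refine Eq.trans (b := (ContinuousLinearMap.id ℝ F).inverse (VectorField.lieBracketWithin ℝ
    (V X) (V Y) ((ψ).symm ⁻¹' univ ∩ range 𝓘(ℝ, F)) (ψ 1)))
    (congrArg (fun A : F →L[ℝ] F => A.inverse (VectorField.lieBracketWithin ℝ
    (V X) (V Y) ((ψ).symm ⁻¹' univ ∩ range 𝓘(ℝ, F)) (ψ 1))) e2) ?_
  rw [e1, VectorField.lieBracketWithin_univ, ContinuousLinearMap.inverse_id,
    ContinuousLinearMap.id_apply]
  exact Filter.EventuallyEq.lieBracket_vectorField_eq (key X) (key Y)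

/-- `actChart F G 1` is the multiplication of `G` in the chart at `1`, so this is
`lieBracket_fundamental`. The sign appears because a left action generates an antihomomorphism into
vector fields. -/
theorem lieBracket_fundField [IsManifold 𝓘(ℝ, E) ∞ M]
    [ContMDiffSMul 𝓘(ℝ, F) 𝓘(ℝ, E) ∞ G M] {x₀ : M} {z : E}
    (hz : z ∈ (extChartAt 𝓘(ℝ, E) x₀).target) (X Y : GroupLieAlgebra 𝓘(ℝ, F) G) :
    VectorField.lieBracket ℝ (fundField F G x₀ X) (fundField F G x₀ Y) z =
      - fundField F G x₀ ⁅X, Y⁆ z := by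
  have h := lieBracket_fundamental (m := actChart F G (1 : G)) (Φ := actChart F G x₀)
    (e := ψ 1) (y := z)
    ((contDiffAt_actChart_one one_mem_target).of_le (by simpa using ENat.LEInfty.out))
    ((contDiffAt_actChart_one hz).of_le (by simpa using ENat.LEInfty.out)) ?_ ?_
    (actChart_one hz) (eventually_actChart_mul hz) X Y
  · rw [← groupLieAlgebra_bracket_eq] at h
    exact h
  · filter_upwards [(isOpen_extChartAt_target (I := 𝓘(ℝ, F)) (1 : G)).mem_nhds
      (mem_extChartAt_target _)] with p hp using actChart_one hp
  · filter_upwards [(isOpen_extChartAt_target (I := 𝓘(ℝ, F)) (1 : G)).mem_nhds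
      (mem_extChartAt_target _)] with p hp
    rw [actChart, symm_one, smul_eq_mul, mul_one, PartialEquiv.right_inv _ hp]

end ChartAction

/-! ### The Killing fields of a homogeneous Riemannian space. -/

section HomogeneousChart

variable {F : Type*} [NormedAddCommGroup F] [NormedSpace ℝ F]
  {G : Type*} [TopologicalSpace G] [ChartedSpace F G] [Group G] [LieGroup 𝓘(ℝ, F) ∞ G]
  {E : Type*} [NormedAddCommGroup E] [NormedSpace ℝ E] [FiniteDimensional ℝ E]
  {M : Type*} [TopologicalSpace M] [ChartedSpace E M] [IsManifold 𝓘(ℝ, E) ∞ M]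
  [MulAction G M] {g : RiemMetric E M} {o : M}

theorem RiemMetric.coord_mfderiv (g : RiemMetric E M) {x₀ z : M} (hz : z ∈ (chartAt E x₀).source)
    (v w : TangentSpace 𝓘(ℝ, E) z) :
    g.coord x₀ (extChartAt 𝓘(ℝ, E) x₀ z)
      (mfderiv 𝓘(ℝ, E) 𝓘(ℝ, E) (extChartAt 𝓘(ℝ, E) x₀) z v)
      (mfderiv 𝓘(ℝ, E) 𝓘(ℝ, E) (extChartAt 𝓘(ℝ, E) x₀) z w) = g.inner z v w := by
  have hz' : z ∈ (extChartAt 𝓘(ℝ, E) x₀).source := by rwa [extChartAt_source]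
  obtain ⟨y, hy, rfl⟩ : ∃ y ∈ (extChartAt 𝓘(ℝ, E) x₀).target, (extChartAt 𝓘(ℝ, E) x₀).symm y = z :=
    ⟨_, (extChartAt 𝓘(ℝ, E) x₀).map_source hz', (extChartAt 𝓘(ℝ, E) x₀).left_inv hz'⟩
  have e1 : ∀ v : TangentSpace 𝓘(ℝ, E) ((extChartAt 𝓘(ℝ, E) x₀).symm y),
    RiemMetric.chartFrame x₀ y (mfderiv 𝓘(ℝ, E) 𝓘(ℝ, E) (extChartAt 𝓘(ℝ, E) x₀)
      ((extChartAt 𝓘(ℝ, E) x₀).symm y) v) = v :=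
    RiemMetric.chartFrame_mfderiv_extChartAt hy
  have e2 : g.coord x₀ y
      (mfderiv 𝓘(ℝ, E) 𝓘(ℝ, E) (extChartAt 𝓘(ℝ, E) x₀) ((extChartAt 𝓘(ℝ, E) x₀).symm y) v)
      (mfderiv 𝓘(ℝ, E) 𝓘(ℝ, E) (extChartAt 𝓘(ℝ, E) x₀) ((extChartAt 𝓘(ℝ, E) x₀).symm y) w) =
      g.inner ((extChartAt 𝓘(ℝ, E) x₀).symm y) v w := by
    refine (g.coord_apply x₀ y _ _).trans ?_
    exact congrArg₂ (fun a b => g.inner ((extChartAt 𝓘(ℝ, E) x₀).symm y) a b) (e1 v) (e1 w)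
  refine Eq.trans (congrArg (fun x => g.coord x₀ x
      (mfderiv 𝓘(ℝ, E) 𝓘(ℝ, E) (extChartAt 𝓘(ℝ, E) x₀) ((extChartAt 𝓘(ℝ, E) x₀).symm y) v)
      (mfderiv 𝓘(ℝ, E) 𝓘(ℝ, E) (extChartAt 𝓘(ℝ, E) x₀) ((extChartAt 𝓘(ℝ, E) x₀).symm y) w))
      ((extChartAt 𝓘(ℝ, E) x₀).right_inv hy)) e2

local notation "ψ" => extChartAt 𝓘(ℝ, F) (1 : G)

/-- The derivative of the action of a fixed group element, in the chart at `x₀`. -/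
theorem fderiv_actChart_right [ContMDiffSMul 𝓘(ℝ, F) 𝓘(ℝ, E) ∞ G M] {x₀ : M} {p : F} {y : E}
    (hp : p ∈ (ψ).target) (hy : y ∈ (extChartAt 𝓘(ℝ, E) x₀).target)
    (h : (ψ).symm p • (extChartAt 𝓘(ℝ, E) x₀).symm y ∈ (chartAt E x₀).source) (u : E) :
    fderiv ℝ (actChart F G x₀) (p, y) (0, u) =
      mfderiv 𝓘(ℝ, E) 𝓘(ℝ, E) (extChartAt 𝓘(ℝ, E) x₀)
        ((ψ).symm p • (extChartAt 𝓘(ℝ, E) x₀).symm y)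
        (mfderiv 𝓘(ℝ, E) 𝓘(ℝ, E) (fun z : M => (ψ).symm p • z) ((extChartAt 𝓘(ℝ, E) x₀).symm y)
          (RiemMetric.chartFrame x₀ y u)) := by
  have h1 := ((contDiffAt_actChart hp hy h).differentiableAt (by simp)).hasFDerivAt
  have h2 : HasFDerivAt (fun q => actChart F G x₀ (p, q)) _ y :=
    HasFDerivAt.comp (g := actChart F G x₀) y h1 (hasFDerivAt_prodMk_right p y)
  let A₁ : E →L[ℝ] E := mfderiv 𝓘(ℝ, E) 𝓘(ℝ, E) (extChartAt 𝓘(ℝ, E) x₀)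
    ((ψ).symm p • (extChartAt 𝓘(ℝ, E) x₀).symm y)
  let A₂ : E →L[ℝ] E := mfderiv 𝓘(ℝ, E) 𝓘(ℝ, E) (fun z : M => (ψ).symm p • z)
    ((extChartAt 𝓘(ℝ, E) x₀).symm y)
  let A₃ : E →L[ℝ] E := RiemMetric.chartFrame x₀ y
  have m1 : MDifferentiableAt 𝓘(ℝ, E) 𝓘(ℝ, E) (extChartAt 𝓘(ℝ, E) x₀)
    ((ψ).symm p • (extChartAt 𝓘(ℝ, E) x₀).symm y) := mdifferentiableAt_extChartAt h
  have m2 : MDifferentiableAt 𝓘(ℝ, E) 𝓘(ℝ, E) (fun z : M => (ψ).symm p • z)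
      ((extChartAt 𝓘(ℝ, E) x₀).symm y) :=
    (ContMDiffSMul.contMDiff_const_smul (I := 𝓘(ℝ, F)) (I' := 𝓘(ℝ, E)) (n := ∞)
      ((ψ).symm p)).contMDiffAt.mdifferentiableAt (by simp)
  have m3 : MDifferentiableAt 𝓘(ℝ, E) 𝓘(ℝ, E) (extChartAt 𝓘(ℝ, E) x₀).symm y :=
    (RiemMetric.contMDiffAt_extChartAt_symm hy).mdifferentiableAt (by simp)
  have h3 : HasFDerivAt (fun q => actChart F G x₀ (p, q)) (A₁.comp (A₂.comp A₃)) y :=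
    (m1.hasMFDerivAt.comp y (m2.hasMFDerivAt.comp y m3.hasMFDerivAt)).hasFDerivAt
  exact DFunLike.congr_fun (h2.unique h3) u

namespace IsHomogeneousRiemannianSpace

theorem isKillingOn_fundField (h : IsHomogeneousRiemannianSpace F G g o) (x₀ : M)
    (X : GroupLieAlgebra 𝓘(ℝ, F) G) :
    IsKillingOn (g.coord x₀) (extChartAt 𝓘(ℝ, E) x₀).target (fundField F G x₀ X) where
  contDiffOn := by
    have := h.smooth
    exact contDiffOn_fundField x₀ X
  killing y hy u v := by
    have := h.smooth
    have : ContinuousSMul G M := ContMDiffSMul.continuousSMul (I := 𝓘(ℝ, F)) (I' := 𝓘(ℝ, E)) ∞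
    have hT := (isOpen_extChartAt_target (I := 𝓘(ℝ, E)) x₀).mem_nhds hy
    refine isKilling_fundamental (Φ := actChart F G x₀) (e := ψ 1)
      (((g.contDiffOn_coord x₀).contDiffAt hT).differentiableAt (by simp))
      ((contDiffAt_actChart_one hy).of_le (by simpa using ENat.LEInfty.out)) ?_ ?_ X u v
    · filter_upwards [hT] with z hz using actChart_one hz
    · have h1 : Tendsto (fun q => (ψ).symm q • (extChartAt 𝓘(ℝ, E) x₀).symm y) (𝓝 (ψ 1))
          (𝓝 ((1 : G) • (extChartAt 𝓘(ℝ, E) x₀).symm y)) :=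
        tendsto_symm_one.smul tendsto_const_nhds
      rw [one_smul] at h1
      filter_upwards [h1.eventually ((isOpen_extChartAt_source (I := 𝓘(ℝ, E)) x₀).mem_nhds
        ((extChartAt 𝓘(ℝ, E) x₀).map_target hy)),
        (isOpen_extChartAt_target (I := 𝓘(ℝ, F)) (1 : G)).mem_nhds
          (mem_extChartAt_target _)] with p hp1 hp2 u v
      rw [extChartAt_source] at hp1
      rw [fderiv_actChart_right hp2 hy hp1, fderiv_actChart_right hp2 hy hp1]
      refine Eq.trans (g.coord_mfderiv hp1 _ _) ?_
      exact h.isometric _ _ _ _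

theorem fundField_self (h : IsHomogeneousRiemannianSpace F G g o)
    (X : GroupLieAlgebra 𝓘(ℝ, F) G) :
    fundField F G o X (extChartAt 𝓘(ℝ, E) o o) =
      mfderiv 𝓘(ℝ, E) 𝓘(ℝ, E) (extChartAt 𝓘(ℝ, E) o) o (infAction F G o X) := by
  have := h.smooth
  refine (fundField_eq (mem_extChartAt_target o) X).trans ?_
  have e : (extChartAt 𝓘(ℝ, E) o).symm (extChartAt 𝓘(ℝ, E) o o) = o := extChartAt_to_inv o
  refine Eq.trans (congrArg (fun x : M => (mfderiv 𝓘(ℝ, E) 𝓘(ℝ, E) (extChartAt 𝓘(ℝ, E) o)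
    ((1 : G) • x) : E →L[ℝ] E)
    ((mfderiv 𝓘(ℝ, F) 𝓘(ℝ, E) (fun a : G => a • x) 1 : F →L[ℝ] E) (X : F))) e) ?_
  exact congrArg (fun x : M => (mfderiv 𝓘(ℝ, E) 𝓘(ℝ, E) (extChartAt 𝓘(ℝ, E) o) x : E →L[ℝ] E)
    ((mfderiv 𝓘(ℝ, F) 𝓘(ℝ, E) (fun a : G => a • o) 1 : F →L[ℝ] E) (X : F))) (one_smul G o)

theorem homInner_eq (h : IsHomogeneousRiemannianSpace F G g o)
    (X Y : GroupLieAlgebra 𝓘(ℝ, F) G) :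
    homInner F G g o X Y = g.coord o (extChartAt 𝓘(ℝ, E) o o)
      (fundField F G o X (extChartAt 𝓘(ℝ, E) o o))
      (fundField F G o Y (extChartAt 𝓘(ℝ, E) o o)) := by
  rw [h.fundField_self, h.fundField_self]
  exact (g.coord_mfderiv (mem_chart_source E o) _ _).symm

theorem homRicci_eq (h : IsHomogeneousRiemannianSpace F G g o) (X : GroupLieAlgebra 𝓘(ℝ, F) G) :
    homRicci F G g o X = LinearMap.trace ℝ E (g.chartCurvature o (extChartAt 𝓘(ℝ, E) o o)
      (fundField F G o X (extChartAt 𝓘(ℝ, E) o o))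
      (fundField F G o X (extChartAt 𝓘(ℝ, E) o o)) : E →ₗ[ℝ] E) := by
  rw [h.fundField_self]
  rfl

theorem fundField_surjective (h : IsHomogeneousRiemannianSpace F G g o) (u : E) :
    ∃ X, fundField F G o X (extChartAt 𝓘(ℝ, E) o o) = u := by
  obtain ⟨X, hX⟩ := h.submersion u
  refine ⟨X, ?_⟩
  rw [h.fundField_self, hX, mfderiv_extChartAt_self]
  rfl

theorem lieBracket_fundField (h : IsHomogeneousRiemannianSpace F G g o) {y : E}
    (hy : y ∈ (extChartAt 𝓘(ℝ, E) o).target) (X Y : GroupLieAlgebra 𝓘(ℝ, F) G) :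
    VectorField.lieBracket ℝ (fundField F G o X) (fundField F G o Y) y =
      - fundField F G o ⁅X, Y⁆ y := by
  have := h.smooth
  exact _root_.lieBracket_fundField hy X Y

end IsHomogeneousRiemannianSpace

end HomogeneousChart

/-! ### Geodesics and the geodesic lemma. -/

section GeodesicLemma

/-- Local existence of geodesics of a smooth connection. -/
theorem exists_local_geodesic {E : Type*} [NormedAddCommGroup E] [NormedSpace ℝ E]
    [CompleteSpace E] {Γ : E → E →L[ℝ] E →L[ℝ] E} {T : Set E} (hT : IsOpen T)
    (hΓ : ContDiffOn ℝ ∞ Γ T) {y : E} (hy : y ∈ T) (v : E) :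
    ∃ c w : ℝ → E, ∃ ε > 0, c 0 = y ∧ w 0 = v ∧ ∀ t ∈ Ioo (-ε) ε, c t ∈ T ∧
      HasDerivAt c (w t) t ∧ HasDerivAt w (-Γ (c t) (w t) (w t)) t := by
  -- The geodesic equation as a first-order system for position and velocity. A solution is only
  -- known to stay in `T` for short time, hence the later shrinking of the interval.
  let f : E × E → E × E := fun p => (p.2, -Γ p.1 p.2 p.2)
  have hf : ContDiffAt ℝ 1 f (y, v) := by
    have h1 : ContDiffAt ℝ 1 (fun p : E × E => Γ p.1) (y, v) :=
      ((hΓ.contDiffAt (hT.mem_nhds hy)).of_le (by simp)).comp (y, v) contDiffAt_fst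
    exact contDiffAt_snd.prodMk ((h1.clm_apply contDiffAt_snd).clm_apply contDiffAt_snd).neg
  obtain ⟨α, h0, ε, hε, hα⟩ :=
    hf.exists_forall_mem_closedBall_exists_eq_forall_mem_Ioo_hasDerivAt₀ 0
  have hc : ContinuousAt (fun t => (α t).1) 0 :=
    (hα 0 (by simpa using hε)).continuousAt.fst
  have h1 : ∀ᶠ t in 𝓝 (0 : ℝ), (α t).1 ∈ T := by
    have h0T : (α 0).1 ∈ T := by rw [h0]; exact hy
    exact hc.eventually (hT.mem_nhds h0T)
  obtain ⟨δ, hδ, hδT⟩ := Metric.eventually_nhds_iff.1 h1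
  refine ⟨fun t => (α t).1, fun t => (α t).2, min ε δ, lt_min hε hδ, by simp [h0], by simp [h0],
    fun t ht => ⟨?_, ?_, ?_⟩⟩
  · refine hδT ?_
    rw [Real.dist_eq, sub_zero, abs_lt]
    exact ⟨lt_of_le_of_lt (neg_le_neg (min_le_right _ _)) ht.1, ht.2.trans_le (min_le_right _ _)⟩
  all_goals
    have ht' : t ∈ Ioo (0 - ε) (0 + ε) := by
      rw [zero_sub, zero_add]
      exact ⟨lt_of_le_of_lt (neg_le_neg (min_le_left _ _)) ht.1, ht.2.trans_le (min_le_left _ _)⟩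
    have := hα t ht'
  · exact this.fst
  · exact this.snd

variable {F : Type*} [NormedAddCommGroup F] [NormedSpace ℝ F]
  {G : Type*} [TopologicalSpace G] [ChartedSpace F G] [Group G] [LieGroup 𝓘(ℝ, F) ∞ G]
  {E : Type*} [NormedAddCommGroup E] [NormedSpace ℝ E] [FiniteDimensional ℝ E]
  {M : Type*} [TopologicalSpace M] [ChartedSpace E M] [IsManifold 𝓘(ℝ, E) ∞ M]
  [MulAction G M] {g : RiemMetric E M} {o : M}

local notation "ψ" => extChartAt 𝓘(ℝ, F) (1 : G)

theorem exists_isGeodesicOn (g : RiemMetric E M) (o : M) (v : E) :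
    ∃ c : ℝ → E, ∃ ε > 0, c 0 = extChartAt 𝓘(ℝ, E) o o ∧ deriv c 0 = v ∧
      (∀ t ∈ Ioo (-ε) ε, c t ∈ (extChartAt 𝓘(ℝ, E) o).target ∧ DifferentiableAt ℝ c t ∧
        deriv (deriv c) t = - g.christoffel o (c t) (deriv c t) (deriv c t)) ∧
      g.IsGeodesicOn (fun t => (extChartAt 𝓘(ℝ, E) o).symm (c t)) (Ioo (-ε) ε) := by
  have : CompleteSpace E := FiniteDimensional.complete ℝ E
  obtain ⟨c, w, ε, hε, c0, w0, h⟩ := exists_local_geodesic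
    (isOpen_extChartAt_target (I := 𝓘(ℝ, E)) o) (g.contDiffOn_christoffel o)
    (mem_extChartAt_target o) v
  have hJ : IsOpen (Ioo (-ε) ε) := isOpen_Ioo
  have h0 : (0 : ℝ) ∈ Ioo (-ε) ε := ⟨by simpa using hε, hε⟩
  have hdc : ∀ t ∈ Ioo (-ε) ε, deriv c t = w t := fun t ht => (h t ht).2.1.deriv
  have hddc : ∀ t ∈ Ioo (-ε) ε,
      deriv (deriv c) t = - g.christoffel o (c t) (deriv c t) (deriv c t) := by
    intro t ht
    have : deriv c =ᶠ[𝓝 t] w := by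
      filter_upwards [hJ.mem_nhds ht] with s hs using hdc s hs
    rw [this.deriv_eq, hdc t ht, (h t ht).2.2.deriv]
  have hcc : ContinuousOn c (Ioo (-ε) ε) := fun t ht =>
    (h t ht).2.1.continuousAt.continuousWithinAt
  have hwc : ContinuousOn w (Ioo (-ε) ε) := fun t ht =>
    (h t ht).2.2.continuousAt.continuousWithinAt
  -- Bootstrap: `w` is continuous, so the equation makes its derivative continuous, and `c` is then
  -- C².
  have hw1 : ContDiffOn ℝ 1 w (Ioo (-ε) ε) := by
    rw [show (1 : ℕ∞ω) = 0 + 1 by simp, contDiffOn_succ_iff_deriv_of_isOpen hJ]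
    refine ⟨fun t ht => (h t ht).2.2.differentiableAt.differentiableWithinAt, by simp, ?_⟩
    rw [contDiffOn_zero]
    have hΓc : ContinuousOn (fun t => g.christoffel o (c t)) (Ioo (-ε) ε) :=
      (g.contDiffOn_christoffel o).continuousOn.comp hcc fun t ht => (h t ht).1
    exact ((hΓc.clm_apply hwc).clm_apply hwc).neg.congr fun t ht => (h t ht).2.2.deriv
  have hc2 : ContDiffOn ℝ 2 c (Ioo (-ε) ε) := by
    rw [show (2 : ℕ∞ω) = 1 + 1 by norm_num, contDiffOn_succ_iff_deriv_of_isOpen hJ]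
    exact ⟨fun t ht => (h t ht).2.1.differentiableAt.differentiableWithinAt, by simp,
      hw1.congr hdc⟩
  refine ⟨c, ε, hε, c0, by rw [hdc 0 h0, w0],
    fun t ht => ⟨(h t ht).1, (h t ht).2.1.differentiableAt, hddc t ht⟩, ?_, ?_⟩
  · exact ((contMDiffOn_extChartAt_symm (I := 𝓘(ℝ, E)) (n := ∞) o).of_le
      (by simpa using ENat.LEInfty.out)).comp hc2.contMDiffOn fun t ht => (h t ht).1
  · intro t ht
    refine ⟨o, RiemMetric.symm_mem_source (h t ht).1, ?_⟩
    have e : (fun s => extChartAt 𝓘(ℝ, E) o ((extChartAt 𝓘(ℝ, E) o).symm (c s))) =ᶠ[𝓝 t] c := by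
      filter_upwards [hJ.mem_nhds ht] with s hs using PartialEquiv.right_inv _ (h s hs).1
    simp only
    rw [e.deriv.deriv_eq, e.deriv_eq, PartialEquiv.right_inv _ (h t ht).1, hddc t ht]
    simp

theorem IsHomogeneousRiemannianSpace.infAction_eq_of_fundField_eq
    (h : IsHomogeneousRiemannianSpace F G g o) {X Y : GroupLieAlgebra 𝓘(ℝ, F) G}
    (hXY : fundField F G o X (extChartAt 𝓘(ℝ, E) o o) =
      fundField F G o Y (extChartAt 𝓘(ℝ, E) o o)) :
    infAction F G (E := E) o X = infAction F G o Y := by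
  rw [h.fundField_self, h.fundField_self, mfderiv_extChartAt_self] at hXY
  exact hXY

/-- The geodesic lemma: in a geodesic orbit space, every tangent vector at `o` is generated by some
`A` with `([A, W], A) = 0` for all `W`. -/
theorem IsHomogeneousRiemannianSpace.exists_geodesic_vector
    (h : IsHomogeneousRiemannianSpace F G g o) (hGO : IsGeodesicOrbit F G g)
    (X : GroupLieAlgebra 𝓘(ℝ, F) G) :
    ∃ A : GroupLieAlgebra 𝓘(ℝ, F) G, infAction F G (E := E) o A = infAction F G o X ∧
      ∀ W, homInner F G g o ⁅A, W⁆ A = 0 := by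
  have := h.smooth
  obtain ⟨c, ε, hε, c0, hc0, hc, hgeo⟩ := exists_isGeodesicOn g o
    (fundField F G o X (extChartAt 𝓘(ℝ, E) o o))
  have hJ : IsOpen (Ioo (-ε) ε) := isOpen_Ioo
  have h0 : (0 : ℝ) ∈ Ioo (-ε) ε := ⟨by simpa using hε, hε⟩
  obtain ⟨a, ha, hadd, horb⟩ := hGO _ _ hJ ordConnected_Ioo h0 hgeo
  have a0 : a 0 = 1 := by
    have := hadd 0 0
    rw [add_zero] at this
    exact left_eq_mul.1 this
  have hp : DifferentiableAt ℝ (fun t => ψ (a t)) 0 := by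
    have h1 : ContMDiffAt 𝓘(ℝ, F) 𝓘(ℝ, F) ∞ (ψ) (a 0) := by
      rw [a0]; exact contMDiffAt_extChartAt
    exact (contMDiffAt_iff_contDiffAt.1 (h1.comp 0 ha.contMDiffAt)).differentiableAt (by simp)
  obtain ⟨A, hA⟩ : ∃ A : GroupLieAlgebra 𝓘(ℝ, F) G, HasDerivAt (fun t => ψ (a t)) (A : F) 0 :=
    ⟨deriv (fun t => ψ (a t)) 0, hp.hasDerivAt⟩
  have hasrc : ∀ᶠ s in 𝓝 (0 : ℝ), a s ∈ (ψ).source := by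
    refine ha.continuous.continuousAt.eventually ?_
    rw [a0]
    exact (isOpen_extChartAt_source (1 : G)).mem_nhds (mem_extChartAt_source _)
  -- Since c(s + t) = a(s) • c(t), differentiating at s = 0 shows that `c` is an integral curve of
  -- the field generated by A = a'(0).
  have hder : ∀ t ∈ Ioo (-ε) ε, deriv c t = fundField F G o A (c t) := by
    intro t ht
    have e1 : (fun s => actChart F G o (ψ (a s), c t)) =ᶠ[𝓝 0] fun s => c (s + t) := by
      have ht' : ∀ᶠ s in 𝓝 (0 : ℝ), s + t ∈ Ioo (-ε) ε := by
        have : Tendsto (fun s : ℝ => s + t) (𝓝 0) (𝓝 (0 + t)) :=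
          (continuous_id.add continuous_const).tendsto 0
        rw [zero_add] at this
        exact this.eventually (hJ.mem_nhds ht)
      filter_upwards [hasrc, ht'] with s hs hst
      rw [actChart, (ψ).left_inv hs, horb t ht, smul_smul, ← hadd, ← horb _ hst]
      exact PartialEquiv.right_inv _ (hc _ hst).1
    have h1 := ((contDiffAt_actChart_one (F := F) (G := G) (hc t ht).1).differentiableAt
      (by simp)).hasFDerivAt
    have h2 : HasDerivAt (fun s => (ψ (a s), c t)) ((A, 0) : F × E) 0 :=
      hA.prodMk (hasDerivAt_const 0 (c t))
    have h3 : HasDerivAt (fun s => actChart F G o (ψ (a s), c t)) (fundField F G o A (c t)) 0 :=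
      HasFDerivAt.comp_hasDerivAt (l := actChart F G o) (f := fun s => (ψ (a s), c t)) 0
        (by rw [a0]; exact h1) h2
    have h4 : HasDerivAt (fun s => c (s + t)) (deriv c t) 0 := by
      have h5 : HasDerivAt c (deriv c t) (0 + t) := by
        rw [zero_add]; exact (hc t ht).2.1.hasDerivAt
      exact h5.comp_add_const 0 t
    exact (h4.unique (h3.congr_of_eventuallyEq e1.symm))
  have hT : c 0 ∈ (extChartAt 𝓘(ℝ, E) o).target := (hc 0 h0).1
  have hLC := g.isLeviCivitaOn o
  have hKA := h.isKillingOn_fundField o A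
  have hdA := hLC.differentiableAt_of_contDiffOn hT hKA.contDiffOn
  -- Differentiating c' = A(c) once more and comparing with c'' = -Γ(c', c') gives ∇_A A = 0 at `o`.
  have hcov : covDeriv (g.christoffel o) (fundField F G o A) (c 0)
      (fundField F G o A (c 0)) = 0 := by
    have e1 : deriv c =ᶠ[𝓝 0] fun t => fundField F G o A (c t) := by
      filter_upwards [hJ.mem_nhds h0] with t ht using hder t ht
    have h1 : HasDerivAt (fun t => fundField F G o A (c t))
        (fderiv ℝ (fundField F G o A) (c 0) (deriv c 0)) 0 :=
      hdA.hasFDerivAt.comp_hasDerivAt 0 (hc 0 h0).2.1.hasDerivAt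
    have h2 := (hc 0 h0).2.2
    rw [e1.deriv_eq, h1.deriv, hder 0 h0] at h2
    rw [covDeriv, h2]
    simp
  refine ⟨A, h.infAction_eq_of_fundField_eq (by rw [← hc0, hder 0 h0, c0]), fun W => ?_⟩
  have h1 := hLC.metric_covDeriv_self (h.isKillingOn_fundField o W) hKA hT
  rw [hcov, h.lieBracket_fundField hT, map_zero, zero_apply, map_neg, neg_apply, c0] at h1
  rw [h.homInner_eq]
  linarith

end GeodesicLemma

/-- The trace of an endomorphism in an orthonormal spanning family. -/
theorem LinearMap.trace_eq_sum_of_orthonormal {E ι : Type*} [AddCommGroup E] [Module ℝ E]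
    [Fintype ι] [DecidableEq ι] (B : E →ₗ[ℝ] E →ₗ[ℝ] ℝ) (b : ι → E)
    (horth : ∀ i j, B (b i) (b j) = if i = j then 1 else 0)
    (hspan : ∀ u, u = ∑ k, B u (b k) • b k) (T : E →ₗ[ℝ] E) :
    LinearMap.trace ℝ E T = ∑ i, B (T (b i)) (b i) := by
  have hli : LinearIndependent ℝ b := by
    rw [Fintype.linearIndependent_iff]
    intro c hc i
    have h1 : B (∑ j, c j • b j) (b i) = c i := by simp [horth]
    rw [hc] at h1
    simpa using h1.symm
  have hs : ⊤ ≤ Submodule.span ℝ (Set.range b) := by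
    intro u _
    rw [hspan u]
    exact Submodule.sum_mem _ fun k _ => Submodule.smul_mem _ _ (Submodule.subset_span ⟨k, rfl⟩)
  let β := Module.Basis.mk hli hs
  have hβ : ∀ i, β i = b i := fun i => by simp [β]
  have hrepr : ∀ u i, β.repr u i = B u (b i) := by
    intro u i
    conv_rhs => rw [← β.sum_repr u]
    simp [hβ, horth]
  rw [LinearMap.trace_eq_matrix_trace ℝ β]
  simp [Matrix.trace, LinearMap.toMatrix_apply, hrepr, hβ]

/-! ### The Ricci curvature through Lie brackets. -/

section HomogeneousRicci

variable {F : Type*} [NormedAddCommGroup F] [NormedSpace ℝ F]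
  {G : Type*} [TopologicalSpace G] [ChartedSpace F G] [Group G] [LieGroup 𝓘(ℝ, F) ∞ G]
  {E : Type*} [NormedAddCommGroup E] [NormedSpace ℝ E] [FiniteDimensional ℝ E]
  {M : Type*} [TopologicalSpace M] [ChartedSpace E M] [IsManifold 𝓘(ℝ, E) ∞ M]
  [MulAction G M] {g : RiemMetric E M} {o : M}

/-- `homInner` as a bilinear form. -/
def homForm (F : Type*) [NormedAddCommGroup F] [NormedSpace ℝ F]
    (G : Type*) [TopologicalSpace G] [ChartedSpace F G] [Group G]
    {E : Type*} [NormedAddCommGroup E] [NormedSpace ℝ E] [FiniteDimensional ℝ E]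
    {M : Type*} [TopologicalSpace M] [ChartedSpace E M] [IsManifold 𝓘(ℝ, E) ∞ M] [MulAction G M]
    (g : RiemMetric E M) (o : M) : LinearMap.BilinForm ℝ (GroupLieAlgebra 𝓘(ℝ, F) G) :=
  LinearMap.mk₂ ℝ (homInner F G g o) (by intros; simp [homInner]) (by intros; simp [homInner])
    (by intros; simp [homInner]) (by intros; simp [homInner])

theorem homForm_apply (X Y : GroupLieAlgebra 𝓘(ℝ, F) G) :
    homForm F G g o X Y = homInner F G g o X Y := rfl

theorem homForm_symm (X Y : GroupLieAlgebra 𝓘(ℝ, F) G) :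
    homForm F G g o X Y = homForm F G g o Y X := g.symm _ _ _

theorem homForm_self_eq_zero {X : GroupLieAlgebra 𝓘(ℝ, F) G} :
    homForm F G g o X X = 0 ↔ X ∈ isotropyAlgebra F G (E := E) o := by
  refine ⟨fun h => ?_, fun h => ?_⟩
  · by_contra hX
    exact (g.pos o (infAction F G o X) hX).ne' h
  · have h' : infAction F G (E := E) o X = 0 := h
    rw [homForm_apply, homInner, h', map_zero]

theorem homForm_self_nonneg (X : GroupLieAlgebra 𝓘(ℝ, F) G) : 0 ≤ homForm F G g o X X := by
  by_cases hX : X ∈ isotropyAlgebra F G (E := E) o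
  · exact (homForm_self_eq_zero.2 hX).ge
  · exact (g.pos o (infAction F G o X) hX).le

theorem homForm_eq_zero_of_mem {X : GroupLieAlgebra 𝓘(ℝ, F) G}
    (hX : X ∈ isotropyAlgebra F G (E := E) o) (Y : GroupLieAlgebra 𝓘(ℝ, F) G) :
    homForm F G g o X Y = 0 := by
  have h' : infAction F G (E := E) o X = 0 := hX
  rw [homForm_apply, homInner, h', map_zero, zero_apply]

namespace IsHomogeneousRiemannianSpace

/-- The isotropy algebra acts by skew-symmetric maps. -/
theorem homForm_skew (h : IsHomogeneousRiemannianSpace F G g o) {H : GroupLieAlgebra 𝓘(ℝ, F) G}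
    (hH : H ∈ isotropyAlgebra F G (E := E) o) (X Y : GroupLieAlgebra 𝓘(ℝ, F) G) :
    homForm F G g o ⁅H, X⁆ Y + homForm F G g o X ⁅H, Y⁆ = 0 := by
  have hT := mem_extChartAt_target (I := 𝓘(ℝ, E)) o
  have hLC := g.isLeviCivitaOn o
  have kX := h.isKillingOn_fundField o X
  have kY := h.isKillingOn_fundField o Y
  have h1 := hLC.fderiv_metric_killing (h.isKillingOn_fundField o H) hT
    (hLC.differentiableAt_of_contDiffOn hT kX.contDiffOn)
    (hLC.differentiableAt_of_contDiffOn hT kY.contDiffOn)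
  have hH' : infAction F G (E := E) o H = 0 := hH
  have h0 : fundField F G o H (extChartAt 𝓘(ℝ, E) o o) = 0 := by
    rw [h.fundField_self, hH', map_zero]; rfl
  -- The field of `H` vanishes at `o`, so the derivative along it is zero and only the bracket terms
  -- remain.
  rw [h0, map_zero, h.lieBracket_fundField hT, h.lieBracket_fundField hT] at h1
  rw [homForm_apply, homForm_apply, h.homInner_eq, h.homInner_eq]
  simp only [map_neg, neg_apply] at h1
  linarith

/-- The covariant derivative of fundamental fields at `o`. -/
theorem coord_covDeriv (h : IsHomogeneousRiemannianSpace F G g o)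
    (X Y Z : GroupLieAlgebra 𝓘(ℝ, F) G) :
    g.coord o (extChartAt 𝓘(ℝ, E) o o)
      (covDeriv (g.christoffel o) (fundField F G o Y) (extChartAt 𝓘(ℝ, E) o o)
        (fundField F G o X (extChartAt 𝓘(ℝ, E) o o)))
      (fundField F G o Z (extChartAt 𝓘(ℝ, E) o o)) =
    -(1 / 2) * (homForm F G g o ⁅X, Y⁆ Z + homForm F G g o ⁅X, Z⁆ Y
      + homForm F G g o ⁅Y, Z⁆ X) := by
  have hT := mem_extChartAt_target (I := 𝓘(ℝ, E)) o
  have h1 := (g.isLeviCivitaOn o).koszul_killing (h.isKillingOn_fundField o X)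
    (h.isKillingOn_fundField o Y) (h.isKillingOn_fundField o Z) hT
  simp only [h.lieBracket_fundField hT, map_neg, neg_apply] at h1
  simp only [homForm_apply, h.homInner_eq]
  linarith

/-- The Ricci curvature of a homogeneous Riemannian space in terms of the Lie algebra. -/
theorem homRicci_eq_sum (h : IsHomogeneousRiemannianSpace F G g o) {ι : Type*} [Fintype ι]
    [DecidableEq ι] (e : ι → GroupLieAlgebra 𝓘(ℝ, F) G)
    (horth : ∀ i j, homForm F G g o (e i) (e j) = if i = j then 1 else 0)
    (hpars : ∀ X Y, homForm F G g o X Y = ∑ k, homForm F G g o X (e k) * homForm F G g o Y (e k))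
    (Y : GroupLieAlgebra 𝓘(ℝ, F) G) :
    homRicci F G g o Y = ∑ i, (homForm F G g o ⁅e i, ⁅Y, e i⁆⁆ Y
      - homForm F G g o ⁅Y, e i⁆ ⁅Y, e i⁆
      - ∑ k, homForm F G g o ⁅Y, e k⁆ Y * homForm F G g o ⁅e i, e k⁆ (e i)
      + 1 / 4 * ∑ k, (homForm F G g o ⁅e i, Y⁆ (e k) + homForm F G g o ⁅e i, e k⁆ Y
          + homForm F G g o ⁅Y, e k⁆ (e i)) ^ 2) := by
  set y := extChartAt 𝓘(ℝ, E) o o with hy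
  have hT : y ∈ (extChartAt 𝓘(ℝ, E) o).target := mem_extChartAt_target (I := 𝓘(ℝ, E)) o
  have hLC := g.isLeviCivitaOn o
  have hq : ∀ X Y, homForm F G g o X Y =
      g.coord o y (fundField F G o X y) (fundField F G o Y y) := fun X Y => h.homInner_eq X Y
  -- Parseval passes from the Lie algebra to the tangent space because every tangent vector at `o`
  -- is the value of a generated field.
  have hpars' : ∀ u v : E, g.coord o y u v = ∑ k, g.coord o y u (fundField F G o (e k) y) *
      g.coord o y v (fundField F G o (e k) y) := by
    intro u v
    obtain ⟨X, rfl⟩ := h.fundField_surjective u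
    obtain ⟨Z, rfl⟩ := h.fundField_surjective v
    have := hpars X Z
    simpa only [hq] using this
  let B : E →ₗ[ℝ] E →ₗ[ℝ] ℝ :=
    (ContinuousLinearMap.coeLM ℝ).comp (g.coord o y : E →ₗ[ℝ] E →L[ℝ] ℝ)
  have hB : ∀ u v, B u v = g.coord o y u v := fun _ _ => rfl
  rw [h.homRicci_eq, LinearMap.trace_eq_sum_of_orthonormal B (fun i => fundField F G o (e i) y)]
  · refine Finset.sum_congr rfl fun i _ => ?_
    have h1 := hLC.metric_curv_killing (h.isKillingOn_fundField o (e i))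
      (h.isKillingOn_fundField o Y) hT
    rw [hB]
    refine Eq.trans h1 ?_
    have e1 : VectorField.lieBracket ℝ (fundField F G o (e i)) (VectorField.lieBracket ℝ
        (fundField F G o Y) (fundField F G o (e i))) y = fundField F G o ⁅e i, ⁅Y, e i⁆⁆ y := by
      have e2 : VectorField.lieBracket ℝ (fundField F G o Y) (fundField F G o (e i)) =ᶠ[𝓝 y]
          (-1 : ℝ) • fundField F G o ⁅Y, e i⁆ := by
        filter_upwards [hLC.isOpen.mem_nhds hT] with z hz
        rw [h.lieBracket_fundField hz]
        simp
      rw [(EventuallyEq.refl _ _).lieBracket_vectorField_eq e2,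
        VectorField.lieBracket_const_smul_right
          (hLC.differentiableAt_of_contDiffOn hT (h.isKillingOn_fundField o _).contDiffOn),
        h.lieBracket_fundField hT]
      simp
    -- Parseval expands the two products of covariant derivatives. Each component given by
    -- `coord_covDeriv` carries ½: for ∇_Y Y and ∇_{e_i} e_i it is absorbed by two equal brackets,
    -- for ∇_{e_i} Y its square is the ¼.
    rw [e1, h.lieBracket_fundField hT, hpars' (covDeriv _ (fundField F G o Y) y _)
      (covDeriv _ (fundField F G o (e i)) y _), hpars' (covDeriv _ (fundField F G o Y) y _)
      (covDeriv _ (fundField F G o Y) y _)]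
    simp only [hy, h.coord_covDeriv, Finset.mul_sum]
    rw [← hy]
    simp only [map_neg, neg_apply, neg_neg, ← hq]
    have hll : ∀ Z W : GroupLieAlgebra 𝓘(ℝ, F) G, homForm F G g o ⁅Z, Z⁆ W = 0 := fun Z W => by
      have : ⁅Z, Z⁆ = (0 : GroupLieAlgebra 𝓘(ℝ, F) G) := by
        rw [GroupLieAlgebra.bracket_def, VectorField.mlieBracket_self]; rfl
      rw [this, map_zero, LinearMap.zero_apply]
    simp only [hll]
    congr 1
    · congr 1
      refine Finset.sum_congr rfl fun k _ => ?_
      ring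
    · refine Finset.sum_congr rfl fun k _ => ?_
      ring
  · intro i j
    rw [hB, ← hq, horth]
  · intro u
    rw [← sub_eq_zero]
    by_contra hne
    refine (g.coord_pos hT hne).ne' ?_
    set w := u - ∑ k, B u (fundField F G o (e k) y) • fundField F G o (e k) y with hw
    have : ∀ v, g.coord o y w v = 0 := by
      intro v
      rw [hw, map_sub, sub_apply, map_sum, sum_apply, hpars' u v, sub_eq_zero]
      refine Finset.sum_congr rfl fun k _ => ?_
      rw [hB, map_smul, smul_apply, smul_eq_mul, g.coord_symm o y v]
    exact this w

end IsHomogeneousRiemannianSpace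

end HomogeneousRicci

/-! ### Compactly embedded subalgebras and the Killing form. -/

section CompactLinearGroups

open Matrix MeasureTheory

/-- A compact group of matrices preserves a scalar product. -/
theorem Matrix.exists_posDef_invariant {n : Type*} [Fintype n] [DecidableEq n]
    (C : Subgroup (Matrix n n ℝ)ˣ) (hC : IsCompact (C : Set (Matrix n n ℝ)ˣ)) :
    ∃ P : Matrix n n ℝ, P.PosDef ∧ ∀ b ∈ C, (b : Matrix n n ℝ)ᵀ * P * b = P := by
  have : CompactSpace C := isCompact_iff_compactSpace.1 hC
  let _ : MeasurableSpace C := borel C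
  have : BorelSpace C := ⟨rfl⟩
  let μ : Measure C := Measure.haar
  -- Averaging over Haar measure, with `a⁻¹` in place of `a`: right multiplication of `c a` by `b`
  -- becomes left translation of `a` by `b⁻¹`, under which the measure is invariant.
  let c : C → Matrix n n ℝ := fun a => ((a⁻¹ : C) : (Matrix n n ℝ)ˣ).val
  let f : C → n → n → ℝ := fun a => (c a)ᵀ * c a
  have hcont : Continuous c :=
    Units.continuous_val.comp (continuous_subtype_val.comp continuous_inv)
  have hf : Continuous f := hcont.matrix_transpose.matrix_mul hcont
  have hint : Integrable f μ :=
    hf.integrable_of_hasCompactSupport (HasCompactSupport.of_compactSpace f)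
  refine ⟨Matrix.of (∫ a, f a ∂μ), ?_, ?_⟩
  · refine Matrix.PosDef.of_dotProduct_mulVec_pos ?_ ?_
    · let L : (n → n → ℝ) →ₗ[ℝ] (n → n → ℝ) :=
        { toFun := fun X => (Matrix.of X)ᵀ
          map_add' := fun _ _ => rfl
          map_smul' := fun _ _ => rfl }
      have h1 : L (∫ a, f a ∂μ) = ∫ a, L (f a) ∂μ :=
        ((LinearMap.toContinuousLinearMap L).integral_comp_comm hint).symm
      have h2 : ∀ a, L (f a) = f a := fun a => by
        change ((c a)ᵀ * c a)ᵀ = (c a)ᵀ * c a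
        rw [Matrix.transpose_mul, Matrix.transpose_transpose]
      simp only [h2] at h1
      exact h1
    · intro v hv
      let L : (n → n → ℝ) →ₗ[ℝ] ℝ :=
        { toFun := fun X => star v ⬝ᵥ (Matrix.of X *ᵥ v)
          map_add' := fun X Z => by
            rw [show Matrix.of (X + Z) = Matrix.of X + Matrix.of Z from rfl, Matrix.add_mulVec,
              dotProduct_add]
          map_smul' := fun r X => by
            rw [show Matrix.of (r • X) = r • Matrix.of X from rfl, Matrix.smul_mulVec,
              dotProduct_smul]; rfl }
      have h1 : L (∫ a, f a ∂μ) = ∫ a, L (f a) ∂μ :=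
        ((LinearMap.toContinuousLinearMap L).integral_comp_comm hint).symm
      have h2 : ∀ a, L (f a) = (c a *ᵥ v) ⬝ᵥ (c a *ᵥ v) := fun a => by
        change star v ⬝ᵥ (((c a)ᵀ * c a) *ᵥ v) = _
        rw [star_trivial, ← Matrix.mulVec_mulVec, Matrix.dotProduct_mulVec, Matrix.vecMul_transpose]
      have h3 : ∀ a, 0 < L (f a) := fun a => by
        rw [h2]
        have : c a *ᵥ v ≠ 0 := fun h0 => hv (by
          have : (((a : C) : (Matrix n n ℝ)ˣ).val * c a) *ᵥ v = 0 := by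
            rw [← Matrix.mulVec_mulVec, h0, Matrix.mulVec_zero]
          simpa [c] using this)
        have h4 := dotProduct_star_self_pos_iff.2 this
        rwa [star_trivial] at h4
      change 0 < L (∫ a, f a ∂μ)
      rw [h1]
      have hLf : Continuous fun a => L (f a) :=
        (LinearMap.toContinuousLinearMap L).continuous.comp hf
      exact hLf.integral_pos_of_hasCompactSupport_nonneg_nonzero
        (HasCompactSupport.of_compactSpace _) (fun a => (h3 a).le) (h3 1).ne'
  · intro b hb
    let L : (n → n → ℝ) →ₗ[ℝ] (n → n → ℝ) :=
      { toFun := fun X => (b : Matrix n n ℝ)ᵀ * Matrix.of X * b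
        map_add' := fun X Z => by
          rw [show Matrix.of (X + Z) = Matrix.of X + Matrix.of Z from rfl, Matrix.mul_add,
            Matrix.add_mul]; rfl
        map_smul' := fun r X => by
          rw [show Matrix.of (r • X) = r • Matrix.of X from rfl, Matrix.mul_smul,
            Matrix.smul_mul]; rfl }
    have h1 : L (∫ a, f a ∂μ) = ∫ a, L (f a) ∂μ :=
      ((LinearMap.toContinuousLinearMap L).integral_comp_comm hint).symm
    have h2 : ∀ a, L (f a) = f ((⟨b, hb⟩⁻¹ : C) * a) := fun a => by
      have h3 : c ((⟨b, hb⟩⁻¹ : C) * a) = c a * b := by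
        simp only [c]
        rfl
      change (b : Matrix n n ℝ)ᵀ * ((c a)ᵀ * c a) * b = (c _)ᵀ * c _
      rw [h3, Matrix.transpose_mul]
      simp only [Matrix.mul_assoc]
    change L (∫ a, f a ∂μ) = ∫ a, f a ∂μ
    rw [h1, ← integral_mul_left_eq_self f (⟨b, hb⟩⁻¹ : C)]
    simp only [h2]

section

open scoped Matrix.Norms.Operator

/-- The derivative of the invariance identity at `t = 0`. -/
theorem Matrix.skew_of_exp_invariant {n : Type*} [Fintype n] [DecidableEq n] {A P : Matrix n n ℝ}
    (h : ∀ t : ℝ, (NormedSpace.exp (t • A))ᵀ * P * NormedSpace.exp (t • A) = P) :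
    Aᵀ * P + P * A = 0 := by
  have h1 : HasDerivAt (fun t : ℝ => NormedSpace.exp (t • A)) A 0 := by
    have := hasDerivAt_exp_smul_const (𝕂 := ℝ) A (0 : ℝ)
    rw [zero_smul, NormedSpace.exp_zero, one_mul] at this
    exact this
  have h2 : HasDerivAt (fun t : ℝ => (NormedSpace.exp (t • A))ᵀ) Aᵀ 0 := by
    let L : Matrix n n ℝ →ₗ[ℝ] Matrix n n ℝ := (Matrix.transposeLinearEquiv n n ℝ ℝ : _ →ₗ[ℝ] _)
    exact (LinearMap.toContinuousLinearMap L).hasFDerivAt.comp_hasDerivAt 0 h1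
  have h3 := (h2.mul_const P).mul h1
  have h4 : HasDerivAt (fun t : ℝ => (NormedSpace.exp (t • A))ᵀ * P * NormedSpace.exp (t • A))
    0 0 := by simp only [h]; exact hasDerivAt_const _ _
  simpa using h3.unique h4

end

-- Write P = SᵀS. Then N = S A S⁻¹ is skew, and tr A² = tr N² = -tr(NᵀN), which vanishes only for N
-- = 0.
open scoped MatrixOrder in
theorem Matrix.eq_zero_of_trace_sq_eq_zero {n : Type*} [Fintype n] [DecidableEq n]
    {A P : Matrix n n ℝ} (hP : P.PosDef) (hA : Aᵀ * P + P * A = 0) (h : (A * A).trace = 0) :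
    A = 0 := by
  obtain ⟨S, hS, hPS⟩ := CStarAlgebra.isStrictlyPositive_iff_eq_star_mul_self.1
    hP.isStrictlyPositive
  rw [Matrix.star_eq_conjTranspose, Matrix.conjTranspose_eq_transpose_of_trivial] at hPS
  obtain ⟨T, hST, hTS⟩ := isUnit_iff_exists.1 hS
  have hTS' : Tᵀ * Sᵀ = 1 := by rw [← Matrix.transpose_mul, hST, Matrix.transpose_one]
  have h1 : (S * A * T)ᵀ = -(S * A * T) := by
    have h2 : Tᵀ * (Aᵀ * P + P * A) * T = (S * A * T)ᵀ + S * A * T := by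
      calc Tᵀ * (Aᵀ * P + P * A) * T
          = Tᵀ * Aᵀ * Sᵀ * (S * T) + (Tᵀ * Sᵀ) * S * A * T := by
            rw [hPS]; noncomm_ring
        _ = (S * A * T)ᵀ + S * A * T := by
            rw [hST, hTS', Matrix.transpose_mul, Matrix.transpose_mul]; noncomm_ring
    rw [hA, Matrix.mul_zero, Matrix.zero_mul] at h2
    exact eq_neg_of_add_eq_zero_left h2.symm
  have h3 : ((S * A * T)ᴴ * (S * A * T)).trace = 0 := by
    have h4 : S * A * T * (S * A * T) = S * (A * A * T) := by
      calc S * A * T * (S * A * T) = S * A * (T * S) * A * T := by noncomm_ring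
        _ = S * (A * A * T) := by rw [hTS]; noncomm_ring
    rw [Matrix.conjTranspose_eq_transpose_of_trivial, h1, Matrix.neg_mul, Matrix.trace_neg, h4,
      Matrix.trace_mul_comm, Matrix.mul_assoc, hTS, Matrix.mul_one, h, neg_zero]
  have h5 := Matrix.trace_conjTranspose_mul_self_eq_zero_iff.1 h3
  calc A = T * S * A * (T * S) := by rw [hTS]; simp
    _ = T * (S * A * T) * S := by noncomm_ring
    _ = 0 := by rw [h5]; simp

/-- The matrices exp(t ad X) lie in a compact group, so ad X is skew for an invariant scalar
product, while the Killing form of X with itself is tr (ad X)². -/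
theorem IsCompactlyEmbedded.eq_zero_of_killingForm_self {L : Type*} [LieRing L] [LieAlgebra ℝ L]
    [FiniteDimensional ℝ L] {𝔨 : LieSubalgebra ℝ L} (h : IsCompactlyEmbedded 𝔨)
    {X : L} (hX : X ∈ 𝔨) (h0 : killingForm ℝ L X X = 0) : LieAlgebra.ad ℝ L X = 0 := by
  obtain ⟨P, hP, hinv⟩ := Matrix.exists_posDef_invariant _ h
  set b := Module.finBasis ℝ L
  have hA := Matrix.skew_of_exp_invariant (A := LinearMap.toMatrix b b (LieAlgebra.ad ℝ L X))
    (P := P) fun t => by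
      have hu : IsUnit (NormedSpace.exp (t • LinearMap.toMatrix b b (LieAlgebra.ad ℝ L X))) :=
        Matrix.isUnit_exp _
      have := hinv hu.unit (Subgroup.subset_closure ⟨t • X, 𝔨.smul_mem t hX, by simp [b]⟩)
      simpa using this
  have h1 := Matrix.eq_zero_of_trace_sq_eq_zero hP hA (by
    rw [← LinearMap.toMatrix_mul, ← LinearMap.trace_eq_matrix_trace]
    exact h0)
  simpa using h1

end CompactLinearGroups

/-! ### Algebraic comparison of the two Ricci curvatures. -/

section LieAlgebraRicci

variable {L : Type*} [LieRing L] [LieAlgebra ℝ L] {q : LinearMap.BilinForm ℝ L}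

/-- The Ricci curvature `Ric(Y, Y)` of a homogeneous space, in terms of the pull-back `q` of the
metric to the Lie algebra and an orthonormal family `e`. -/
def lieRicci {ι : Type*} [Fintype ι] (q : LinearMap.BilinForm ℝ L) (e : ι → L) (Y : L) : ℝ :=
  ∑ i, (q ⁅e i, ⁅Y, e i⁆⁆ Y - q ⁅Y, e i⁆ ⁅Y, e i⁆ - ∑ k, q ⁅Y, e k⁆ Y * q ⁅e i, e k⁆ (e i)
      + 1 / 4 * ∑ k, (q ⁅e i, Y⁆ (e k) + q ⁅e i, e k⁆ Y + q ⁅Y, e k⁆ (e i)) ^ 2)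

/-- The mean curvature term of `lieRicci` vanishes on geodesic vectors. -/
theorem sum_meanCurvature_eq_zero {ι : Type*} [Fintype ι] (hq : ∀ X Y, q X Y = q Y X)
    {Z : L} (hZ : ∀ X Y, q ⁅Z, X⁆ Y + q X ⁅Z, Y⁆ = 0) (e : ι → L)
    (he : ∀ l, ⁅Z, e l⁆ = ∑ k, q ⁅Z, e l⁆ (e k) • e k) {Y : L}
    (hY : ∀ W, q ⁅Y + Z, W⁆ Y = 0) :
    ∑ i, ∑ k, q ⁅Y, e k⁆ Y * q ⁅e i, e k⁆ (e i) = 0 := by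
  have hanti : ∀ k l, q ⁅Z, e k⁆ (e l) = -q ⁅Z, e l⁆ (e k) := by
    intro k l
    have := hZ (e k) (e l)
    rw [hq (e k)] at this
    linarith
  -- Up to sign this is the trace of ad [Z, e_l] = [ad Z, ad e_l] compressed to the span of `e`. As
  -- ad Z is skew and preserves that span, it vanishes like the trace of a commutator.
  have htr : ∀ l, ∑ i, q ⁅e i, ⁅Z, e l⁆⁆ (e i) = 0 := by
    intro l
    have h1 : ∀ i, q ⁅e i, ⁅Z, e l⁆⁆ (e i) =
        -(∑ k, q ⁅Z, e i⁆ (e k) * q ⁅e k, e l⁆ (e i))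
        - ∑ k, q ⁅Z, e i⁆ (e k) * q ⁅e i, e l⁆ (e k) := by
      intro i
      have h2 := hZ ⁅e i, e l⁆ (e i)
      have h3 : q ⁅⁅Z, e i⁆, e l⁆ (e i) = ∑ k, q ⁅Z, e i⁆ (e k) * q ⁅e k, e l⁆ (e i) := by
        conv_lhs => rw [he i]
        simp [sum_lie]
      have h4 : q ⁅e i, e l⁆ ⁅Z, e i⁆ = ∑ k, q ⁅Z, e i⁆ (e k) * q ⁅e i, e l⁆ (e k) := by
        conv_lhs => rw [he i]
        simp
      have h5 : ⁅e i, ⁅Z, e l⁆⁆ = -⁅⁅Z, e i⁆, e l⁆ + ⁅Z, ⁅e i, e l⁆⁆ := by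
        rw [leibniz_lie (e i) Z (e l), ← neg_lie, lie_skew]
      rw [h5, map_add, map_neg]
      simp only [LinearMap.add_apply, LinearMap.neg_apply]
      linarith
    simp only [h1, Finset.sum_sub_distrib, Finset.sum_neg_distrib]
    rw [Finset.sum_comm (f := fun i k => q ⁅Z, e i⁆ (e k) * q ⁅e i, e l⁆ (e k))]
    rw [← neg_add', neg_eq_zero, ← Finset.sum_add_distrib]
    refine Finset.sum_eq_zero fun i _ => ?_
    rw [← Finset.sum_add_distrib]
    refine Finset.sum_eq_zero fun k _ => ?_
    rw [hanti i k]
    ring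
  -- The geodesic condition trades `Y` for `-Z` in the bracket; hence the vector with these
  -- components is [Z, ·] applied to the `e`-part of `Y`, and `htr` applies.
  have hYk : ∀ k, q ⁅Y, e k⁆ Y = ∑ l, q Y (e l) * q ⁅Z, e l⁆ (e k) := by
    intro k
    have h1 := hY (e k)
    have h3 : q ⁅Z, e k⁆ Y = ∑ l, q ⁅Z, e k⁆ (e l) * q (e l) Y := by
      conv_lhs => rw [he k]
      simp
    rw [add_lie, map_add, LinearMap.add_apply, h3] at h1
    rw [eq_neg_of_add_eq_zero_left h1, ← Finset.sum_neg_distrib]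
    refine Finset.sum_congr rfl fun l _ => ?_
    rw [hanti k l, hq Y]
    ring
  have h5 : ∀ i, ∑ k, q ⁅Y, e k⁆ Y * q ⁅e i, e k⁆ (e i) =
      ∑ l, q Y (e l) * q ⁅e i, ⁅Z, e l⁆⁆ (e i) := by
    intro i
    simp only [hYk, Finset.sum_mul]
    rw [Finset.sum_comm]
    refine Finset.sum_congr rfl fun l _ => ?_
    conv_rhs => rw [he l]
    simp [lie_sum, Finset.mul_sum, mul_assoc]
  simp only [h5]
  rw [Finset.sum_comm]
  refine Finset.sum_eq_zero fun l _ => ?_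
  rw [← Finset.mul_sum, htr, mul_zero]

/-- Comparison of the Ricci curvatures of `G/H` and `K/H`. The family `a` is an orthonormal basis
of the tangent space of `K/H` and `y` one of its orthogonal complement. -/
theorem lieRicci_sumElim {ι : Type*} [Fintype ι] {s : ℕ} (hq : ∀ X Y, q X Y = q Y X)
    {𝔥 : Submodule ℝ L} (h𝔥 : ∀ Z ∈ 𝔥, ∀ X, q Z X = 0)
    (hskew : ∀ Z ∈ 𝔥, ∀ X Y, q ⁅Z, X⁆ Y + q X ⁅Z, Y⁆ = 0)
    {𝔨 : LieSubalgebra ℝ L} (h𝔨 : 𝔥 ≤ 𝔨.toSubmodule)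
    (a : ι → L) (y : Fin s → L) (ha𝔨 : ∀ i, a i ∈ 𝔨) (hy : ∀ U ∈ 𝔨, ∀ j, q U (y j) = 0)
    (hdec : ∀ V : L, V - (∑ i, q V (a i) • a i + ∑ j, q V (y j) • y j) ∈ 𝔥)
    (haZ : ∀ Z ∈ 𝔥, ∀ l, ⁅Z, a l⁆ = ∑ k, q ⁅Z, a l⁆ (a k) • a k)
    (hyZ : ∀ Z ∈ 𝔥, ∀ l, ⁅Z, y l⁆ = ∑ k, q ⁅Z, y l⁆ (y k) • y k)
    (hGO : ∀ X, ∃ Z ∈ 𝔥, ∀ W, q ⁅X + Z, W⁆ X = 0) {X : L} (hX𝔨 : X ∈ 𝔨) :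
    lieRicci q (Sum.elim a y) X = lieRicci q a X
      + 1 / 2 * ∑ i : Fin s, ∑ j ∈ Finset.Ioi i, q ⁅y i, y j⁆ X ^ 2 := by
  -- consequences of the geodesic orbit property
  have hAskew : ∀ U ∈ 𝔨, ∀ j k, q ⁅U, y j⁆ (y k) = -q ⁅U, y k⁆ (y j) := by
    have h1 : ∀ U ∈ 𝔨, ∀ V ∈ Submodule.span ℝ (Set.range y), q ⁅U, V⁆ V = 0 := by
      intro U hU V hV
      obtain ⟨Z, hZ, h2⟩ := hGO V
      -- The correction `Z` does not contribute: [Z, U] lies in 𝔨, which is orthogonal to the span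
      -- of `y`. Polarization in `V` then gives skewness.
      have h3 := h2 U
      have h4 : q ⁅Z, U⁆ V = 0 := by
        have h5 : ⁅Z, U⁆ ∈ 𝔨 := 𝔨.lie_mem (h𝔨 hZ) hU
        refine Submodule.span_induction (p := fun V _ => q ⁅Z, U⁆ V = 0) ?_ ?_ ?_ ?_ hV
        · rintro _ ⟨j, rfl⟩; exact hy _ h5 j
        · simp
        · intro u v _ _ hu hv; rw [map_add, hu, hv, add_zero]
        · intro c u _ hu; rw [map_smul, hu, smul_zero]
      rw [add_lie, map_add, LinearMap.add_apply, h4, add_zero, ← lie_skew, map_neg,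
        LinearMap.neg_apply, neg_eq_zero] at h3
      exact h3
    intro U hU j k
    have mj : ∀ j, y j ∈ Submodule.span ℝ (Set.range y) := fun j => Submodule.subset_span ⟨j, rfl⟩
    have h2 := h1 U hU _ (Submodule.add_mem _ (mj j) (mj k))
    rw [lie_add, map_add, map_add, LinearMap.add_apply, LinearMap.add_apply, h1 U hU _ (mj j),
      h1 U hU _ (mj k)] at h2
    linarith
  -- Here the correction drops out because `Z` preserves the span of `y`. Together with `hy`, the
  -- polarized identity says that ∇_U V has no component along `y`.
  have hDskew : ∀ U V, U ∈ 𝔨 → V ∈ 𝔨 → ∀ j, q ⁅U, y j⁆ V + q ⁅V, y j⁆ U = 0 := by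
    have h1 : ∀ U ∈ 𝔨, ∀ j, q ⁅U, y j⁆ U = 0 := by
      intro U hU j
      obtain ⟨Z, hZ, h2⟩ := hGO U
      have h3 := h2 (y j)
      have h4 : q ⁅Z, y j⁆ U = 0 := by
        rw [hyZ Z hZ j]
        simp only [map_sum, map_smul, LinearMap.sum_apply, LinearMap.smul_apply]
        refine Finset.sum_eq_zero fun k _ => ?_
        rw [hq (y k), hy U hU, smul_zero]
      rw [add_lie, map_add, LinearMap.add_apply, h4, add_zero] at h3
      exact h3
    intro U V hU hV j
    have h2 := h1 (U + V) (𝔨.add_mem hU hV) j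
    rw [add_lie, map_add, map_add, LinearMap.add_apply, LinearMap.add_apply, h1 U hU j,
      h1 V hV j] at h2
    linarith
  obtain ⟨Z, hZ, hXZ⟩ := hGO X
  have t1 := sum_meanCurvature_eq_zero hq (hskew Z hZ) a (haZ Z hZ) hXZ
  have t2 := sum_meanCurvature_eq_zero hq (hskew Z hZ) (Sum.elim a y) (by
    rintro (l | l)
    · have h1 : ∑ j, q ⁅Z, a l⁆ (y j) • y j = 0 := Finset.sum_eq_zero fun j _ => by
        rw [hy _ (𝔨.lie_mem (h𝔨 hZ) (ha𝔨 l)) j, zero_smul]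
      simp only [Fintype.sum_sum_type, Sum.elim_inl, Sum.elim_inr, h1, add_zero]
      exact haZ Z hZ l
    · have h1 : ∑ i, q ⁅Z, y l⁆ (a i) • a i = 0 := Finset.sum_eq_zero fun i _ => by
        have h2 : q ⁅Z, y l⁆ (a i) = 0 := by
          rw [hyZ Z hZ l]
          simp only [map_sum, map_smul, LinearMap.sum_apply, LinearMap.smul_apply]
          exact Finset.sum_eq_zero fun k _ => by rw [hq (y k), hy _ (ha𝔨 i), smul_zero]
        rw [h2, zero_smul]
      simp only [Fintype.sum_sum_type, Sum.elim_inl, Sum.elim_inr, h1, zero_add]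
      exact hyZ Z hZ l) hXZ
  have split : ∀ {κ : Type _} [Fintype κ] (e : κ → L),
      ∑ i, ∑ k, q ⁅X, e k⁆ X * q ⁅e i, e k⁆ (e i) = 0 →
      lieRicci q e X = ∑ i, (q ⁅e i, ⁅X, e i⁆⁆ X - q ⁅X, e i⁆ ⁅X, e i⁆
      + 1 / 4 * ∑ k, (q ⁅e i, X⁆ (e k) + q ⁅e i, e k⁆ X + q ⁅X, e k⁆ (e i)) ^ 2) := by
    intro κ _ e h0
    rw [← sub_zero (∑ i, _), ← h0, ← Finset.sum_sub_distrib, lieRicci]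
    refine Finset.sum_congr rfl fun i _ => ?_
    ring
  rw [split _ t1, split _ t2]
  simp only [Fintype.sum_sum_type, Sum.elim_inl, Sum.elim_inr]
  -- the terms of `a` are unchanged
  have ha : ∀ i j, q ⁅a i, X⁆ (y j) + q ⁅a i, y j⁆ X + q ⁅X, y j⁆ (a i) = 0 := by
    intro i j
    rw [hy _ (𝔨.lie_mem (ha𝔨 i) hX𝔨) j]
    have := hDskew (a i) X (ha𝔨 i) hX𝔨 j
    linarith
  -- the terms of `y`
  have hb : ∀ j, q ⁅y j, ⁅X, y j⁆⁆ X - q ⁅X, y j⁆ ⁅X, y j⁆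
      + 1 / 4 * (∑ i, (q ⁅y j, X⁆ (a i) + q ⁅y j, a i⁆ X + q ⁅X, a i⁆ (y j)) ^ 2
        + ∑ k, (q ⁅y j, X⁆ (y k) + q ⁅y j, y k⁆ X + q ⁅X, y k⁆ (y j)) ^ 2) =
      1 / 4 * ∑ k, q ⁅y j, y k⁆ X ^ 2 := by
    intro j
    have hD : ∀ i, q ⁅y j, a i⁆ X = q ⁅X, y j⁆ (a i) := by
      intro i
      have := hDskew (a i) X (ha𝔨 i) hX𝔨 j
      rw [← lie_skew, map_neg, LinearMap.neg_apply]
      linarith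
    have h1 : ∀ i, q ⁅y j, X⁆ (a i) + q ⁅y j, a i⁆ X + q ⁅X, a i⁆ (y j) = 0 := by
      intro i
      rw [hy _ (𝔨.lie_mem hX𝔨 (ha𝔨 i)) j, hD i, ← lie_skew, map_neg, LinearMap.neg_apply]
      ring
    have h2 : ∀ k, q ⁅y j, X⁆ (y k) + q ⁅y j, y k⁆ X + q ⁅X, y k⁆ (y j) =
        q ⁅y j, y k⁆ X - 2 * q ⁅X, y j⁆ (y k) := by
      intro k
      rw [hAskew X hX𝔨 k j, ← lie_skew, map_neg, LinearMap.neg_apply]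
      ring
    -- The isotropy part `H` of [X, y_j] is invisible: it is null for `q`, and q([y_j, H], X) = 0 by
    -- skewness of ad H, as [H, X] ∈ 𝔨 is orthogonal to y_j.
    set H := ⁅X, y j⁆ - (∑ i, q ⁅X, y j⁆ (a i) • a i + ∑ k, q ⁅X, y j⁆ (y k) • y k) with hH
    have hH𝔥 : H ∈ 𝔥 := hdec _
    have hXy : ⁅X, y j⁆ =
        (∑ i, q ⁅X, y j⁆ (a i) • a i + ∑ k, q ⁅X, y j⁆ (y k) • y k) + H := by rw [hH]; abel
    have h3 : q ⁅y j, H⁆ X = 0 := by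
      have := hskew H hH𝔥 (y j) X
      rw [hq (y j), hy _ (𝔨.lie_mem (h𝔨 hH𝔥) hX𝔨) j, add_zero] at this
      rw [← lie_skew, map_neg, LinearMap.neg_apply, this, neg_zero]
    have h4 : q ⁅y j, ⁅X, y j⁆⁆ X =
        ∑ i, q ⁅X, y j⁆ (a i) ^ 2 + ∑ k, q ⁅X, y j⁆ (y k) * q ⁅y j, y k⁆ X := by
      conv_lhs => rw [hXy]
      simp only [lie_add, lie_sum, lie_smul, map_add, map_sum, map_smul,
        LinearMap.add_apply, LinearMap.sum_apply, LinearMap.smul_apply, smul_eq_mul, h3, add_zero,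
        hD, pow_two]
    have h5 : q ⁅X, y j⁆ ⁅X, y j⁆ =
        ∑ i, q ⁅X, y j⁆ (a i) ^ 2 + ∑ k, q ⁅X, y j⁆ (y k) ^ 2 := by
      have h6 : q ⁅X, y j⁆ H = 0 := by rw [hq]; exact h𝔥 _ hH𝔥 _
      have h7 : q ⁅X, y j⁆ ⁅X, y j⁆ = q ⁅X, y j⁆
        ((∑ i, q ⁅X, y j⁆ (a i) • a i + ∑ k, q ⁅X, y j⁆ (y k) • y k) + H) := by rw [← hXy]
      rw [h7]
      simp only [map_add, map_sum, map_smul, smul_eq_mul, h6, add_zero, pow_two]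
    simp only [h1, h2, h4, h5]
    -- After multiplication by ¼, the cross terms and the squares of q([X, y_j], y_k) cancel against
    -- `h4` minus `h5`.
    have h8 : ∑ k, (q ⁅y j, y k⁆ X - 2 * q ⁅X, y j⁆ (y k)) ^ 2 = ∑ k, q ⁅y j, y k⁆ X ^ 2
        - 4 * ∑ k, q ⁅X, y j⁆ (y k) * q ⁅y j, y k⁆ X + 4 * ∑ k, q ⁅X, y j⁆ (y k) ^ 2 := by
      rw [Finset.mul_sum, Finset.mul_sum, ← Finset.sum_sub_distrib, ← Finset.sum_add_distrib]
      refine Finset.sum_congr rfl fun k _ => ?_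
      ring
    rw [h8]
    simp only [ne_eq, OfNat.ofNat_ne_zero, not_false_eq_true, zero_pow, Finset.sum_const_zero]
    ring
  simp only [ha, hb]
  simp only [ne_eq, OfNat.ofNat_ne_zero, not_false_eq_true, zero_pow, Finset.sum_const_zero,
    add_zero]
  congr 1
  -- symmetrization of the double sum
  have hbsymm : ∀ j k, q ⁅y j, y k⁆ X ^ 2 = q ⁅y k, y j⁆ X ^ 2 := by
    intro j k
    rw [← lie_skew, map_neg, LinearMap.neg_apply, neg_sq]
  have hbdiag : ∀ j, q ⁅y j, y j⁆ X ^ 2 = 0 := by simp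
  have h9 : ∀ j : Fin s, ∑ k, q ⁅y j, y k⁆ X ^ 2 = ∑ k ∈ Finset.Ioi j, q ⁅y j, y k⁆ X ^ 2
      + ∑ k ∈ Finset.Iio j, q ⁅y j, y k⁆ X ^ 2 := by
    intro j
    rw [← Finset.sum_union (by
      rw [Finset.disjoint_left]; intro k h1 h2
      exact lt_asymm (Finset.mem_Ioi.1 h1) (Finset.mem_Iio.1 h2))]
    refine (Finset.sum_subset (Finset.subset_univ _) fun k _ hk => ?_).symm
    have : k = j := by
      simp only [Finset.mem_union, Finset.mem_Ioi, Finset.mem_Iio, not_or, not_lt] at hk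
      exact le_antisymm hk.1 hk.2
    rw [this, hbdiag]
  have h10 : ∑ j : Fin s, ∑ k ∈ Finset.Iio j, q ⁅y j, y k⁆ X ^ 2 =
      ∑ j : Fin s, ∑ k ∈ Finset.Ioi j, q ⁅y j, y k⁆ X ^ 2 := by
    rw [Finset.sum_comm' (t' := Finset.univ) (s' := fun k => Finset.Ioi k) (by simp)]
    exact Finset.sum_congr rfl fun j _ => Finset.sum_congr rfl fun k _ => hbsymm k j
  rw [← Finset.mul_sum]
  simp only [h9, Finset.sum_add_distrib, h10]
  ring

end LieAlgebraRicci

/-- Every finite-dimensional subspace on which a symmetric bilinear form is positive definite has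
an orthonormal basis. -/
theorem Submodule.exists_orthonormal_family {V : Type*} [AddCommGroup V] [Module ℝ V]
    (W : Submodule ℝ V) [FiniteDimensional ℝ W] (q : LinearMap.BilinForm ℝ V)
    (hq : ∀ X Y, q X Y = q Y X) (hpos : ∀ X ∈ W, X ≠ 0 → 0 < q X X) :
    ∃ (n : ℕ) (a : Fin n → V), (∀ i, a i ∈ W) ∧ (∀ i j, q (a i) (a j) = if i = j then 1 else 0) ∧
      ∀ X ∈ W, X = ∑ k, q X (a k) • a k := by
  let c : InnerProductSpace.Core ℝ W :=
    { inner := fun u v => q u v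
      conj_inner_symm := fun u v => hq _ _
      re_inner_nonneg := fun u => by
        rcases eq_or_ne u 0 with rfl | hu
        · simp
        · exact (hpos u u.2 fun h => hu (Subtype.ext h)).le
      add_left := fun u v w => by simp
      smul_left := fun u v r => by simp
      definite := fun u hu => by
        by_contra h
        exact (hpos u u.2 fun h' => h (Subtype.ext h')).ne' hu }
  let _ : NormedAddCommGroup W := c.toNormedAddCommGroup
  let _ : InnerProductSpace ℝ W := InnerProductSpace.ofCore c.toCore
  let b := stdOrthonormalBasis ℝ W
  have hinner : ∀ u v : W, inner ℝ u v = q u v := fun _ _ => rfl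
  refine ⟨_, fun i => b i, fun i => (b i).2, fun i j => ?_, fun X hX => ?_⟩
  · rw [← hinner]
    exact orthonormal_iff_ite.1 b.orthonormal i j
  · have h1 := congrArg (Submodule.subtype W) (b.sum_repr' ⟨X, hX⟩)
    simp only [map_sum, map_smul, Submodule.subtype_apply] at h1
    rw [← h1]
    refine Finset.sum_congr rfl fun k _ => ?_
    rw [h1, hinner, hq]

/-! ### The decomposition 𝔤 = 𝔥 ⊕ 𝔪₁ ⊕ 𝔪₂ and its invariance under 𝔥. -/

section ReductiveDecomposition

variable {L : Type*} [LieRing L] [LieAlgebra ℝ L]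

theorem LinearMap.BilinForm.eq_sum_of_mem_span {q : LinearMap.BilinForm ℝ L} {s : ℕ}
    {y : Fin s → L} (hy : ∀ i j, q (y i) (y j) = if i = j then 1 else 0) {X : L}
    (hX : X ∈ Submodule.span ℝ (Set.range y)) : X = ∑ k, q X (y k) • y k := by
  induction hX using Submodule.span_induction with
  | mem _ h =>
    obtain ⟨i, rfl⟩ := h
    simp [hy]
  | zero => simp
  | add u v _ _ hu hv =>
    conv_lhs => rw [hu, hv]
    simp [add_smul, Finset.sum_add_distrib]
  | smul c u _ hu =>
    conv_lhs => rw [hu]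
    simp [Finset.smul_sum, mul_smul]

/-- A compactly embedded subspace of a semisimple Lie algebra is complemented by its orthogonal
with respect to the Killing form. -/
theorem isCompl_orthogonal_killingForm [FiniteDimensional ℝ L] [LieAlgebra.IsSemisimple ℝ L]
    {𝔨 : LieSubalgebra ℝ L} (h𝔨 : IsCompactlyEmbedded 𝔨) {𝔥 : Submodule ℝ L}
    (h𝔥 : 𝔥 ≤ 𝔨.toSubmodule) :
    IsCompl 𝔥 (LinearMap.BilinForm.orthogonal (killingForm ℝ L) 𝔥) := by
  refine (LinearMap.BilinForm.isCompl_orthogonal_iff_disjoint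
    (LieModule.traceForm_isSymm ℝ L L).isRefl).2 (Submodule.disjoint_def.2 fun X hX hX' => ?_)
  have h1 := h𝔨.eq_zero_of_killingForm_self (h𝔥 hX)
    (LinearMap.BilinForm.mem_orthogonal_iff.1 hX' X hX)
  have h2 : X ∈ LieAlgebra.center ℝ L := (LieModule.mem_maxTrivSubmodule ℝ L L X).2 fun Y => by
    rw [← lie_skew, ← LieAlgebra.ad_apply ℝ, h1, LinearMap.zero_apply, neg_zero]
  rw [LieAlgebra.center_eq_bot] at h2
  exact (LieSubmodule.mem_bot X).1 h2

/-- The comparison of Ricci curvatures at the level of Lie algebras. -/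
theorem exists_adapted_basis [FiniteDimensional ℝ L] {q : LinearMap.BilinForm ℝ L}
    (hq : ∀ X Y, q X Y = q Y X) (hnonneg : ∀ X, 0 ≤ q X X) {𝔥 : Submodule ℝ L}
    (hker : ∀ {X}, q X X = 0 ↔ X ∈ 𝔥) (h𝔥 : ∀ Z ∈ 𝔥, ∀ X, q Z X = 0)
    (hskew : ∀ Z ∈ 𝔥, ∀ X Y, q ⁅Z, X⁆ Y + q X ⁅Z, Y⁆ = 0)
    (h𝔥compl : IsCompl 𝔥 (LinearMap.BilinForm.orthogonal (killingForm ℝ L) 𝔥))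
    {𝔨 : LieSubalgebra ℝ L} {𝔪₁ 𝔪₂ : Submodule ℝ L}
    (h𝔪 : 𝔪₁ ⊔ 𝔪₂ = LinearMap.BilinForm.orthogonal (killingForm ℝ L) 𝔥)
    (h𝔪₁ : 𝔥 ⊔ 𝔪₁ = 𝔨.toSubmodule) (horth : ∀ X ∈ 𝔪₁, ∀ Y ∈ 𝔪₂, q X Y = 0)
    {s : ℕ} {y : Fin s → L} (hyspan : Submodule.span ℝ (Set.range y) = 𝔪₂)
    (hy : ∀ i j, q (y i) (y j) = if i = j then 1 else 0)
    (hGO : ∀ X, ∃ Z ∈ 𝔥, ∀ W, q ⁅X + Z, W⁆ X = 0) :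
    IsCompl 𝔪₁ (𝔥 ⊔ 𝔪₂) ∧ ∃ (n : ℕ) (a : Fin n → L), (∀ i, a i ∈ 𝔪₁) ∧
      (∀ i j, q (a i) (a j) = if i = j then 1 else 0) ∧
      (∀ V, V - (∑ i, q V (a i) • a i + ∑ j, q V (y j) • y j) ∈ 𝔥) ∧
      (∀ U ∈ 𝔨, U - ∑ i, q U (a i) • a i ∈ 𝔥) ∧
      ∀ X ∈ 𝔪₁, lieRicci q (Sum.elim a y) X = lieRicci q a X
        + 1 / 2 * ∑ i : Fin s, ∑ j ∈ Finset.Ioi i, q ⁅y i, y j⁆ X ^ 2 := by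
  have h0 : ∀ X ∈ 𝔥, X ∈ 𝔪₁ ⊔ 𝔪₂ → X = 0 := fun X h1 h2 =>
    Submodule.disjoint_def.1 h𝔥compl.disjoint X h1 (h𝔪 ▸ h2)
  have hm₁ : 𝔪₁ ≤ 𝔪₁ ⊔ 𝔪₂ := le_sup_left
  have hm₂ : 𝔪₂ ≤ 𝔪₁ ⊔ 𝔪₂ := le_sup_right
  have h𝔥𝔨 : 𝔥 ≤ 𝔨.toSubmodule := h𝔪₁ ▸ le_sup_left
  have h𝔪𝔨 : 𝔪₁ ≤ 𝔨.toSubmodule := h𝔪₁ ▸ le_sup_right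
  have ymem : ∀ j, y j ∈ 𝔪₂ := fun j => hyspan ▸ Submodule.subset_span ⟨j, rfl⟩
  have hcompl : IsCompl 𝔪₁ (𝔥 ⊔ 𝔪₂) := by
    refine IsCompl.of_eq (Submodule.disjoint_def.2 fun X hX hX' => ?_).eq_bot ?_
    · obtain ⟨Z, hZ, W, hW, rfl⟩ := Submodule.mem_sup.1 hX'
      have h1 : Z = 0 := h0 Z hZ (by simpa using Submodule.sub_mem _ (hm₁ hX) (hm₂ hW))
      rw [h1, zero_add] at hX ⊢
      exact h0 W (hker.1 (horth W hX W hW)) (hm₁ hX)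
    · rw [sup_left_comm, h𝔪]
      exact h𝔥compl.sup_eq_top
  obtain ⟨n, a, ha, haorth, haexp⟩ := 𝔪₁.exists_orthonormal_family q hq fun X hX hX0 =>
    lt_of_le_of_ne (hnonneg X) fun h => hX0 (h0 X (hker.1 h.symm) (hm₁ hX))
  have hyexp : ∀ X ∈ 𝔪₂, X = ∑ k, q X (y k) • y k := fun X hX =>
    LinearMap.BilinForm.eq_sum_of_mem_span hy (hyspan.symm ▸ hX)
  -- By skewness q([Z, X], [Z, X]) = -q(X, [Z, [Z, X]]) = 0, so [Z, X] is a null vector.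
  have hlie𝔥 : ∀ Z ∈ 𝔥, ∀ X ∈ 𝔥, ⁅Z, X⁆ ∈ 𝔥 := by
    intro Z hZ X hX
    have := hskew Z hZ X ⁅Z, X⁆
    rw [h𝔥 X hX, add_zero] at this
    exact hker.1 this
  have hlie𝔪 : ∀ Z ∈ 𝔥, ∀ X ∈ 𝔪₁ ⊔ 𝔪₂, ⁅Z, X⁆ ∈ 𝔪₁ ⊔ 𝔪₂ := by
    intro Z hZ X hX
    rw [h𝔪, LinearMap.BilinForm.mem_orthogonal_iff] at hX ⊢
    intro N hN
    rw [killingForm, ← LieModule.traceForm_apply_lie_apply, ← lie_skew, map_neg,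
      LinearMap.neg_apply, neg_eq_zero]
    exact hX _ (hlie𝔥 Z hZ N hN)
  have hlie𝔪₁ : ∀ Z ∈ 𝔥, ∀ X ∈ 𝔪₁, ⁅Z, X⁆ ∈ 𝔪₁ := by
    intro Z hZ X hX
    have h1 : ⁅Z, X⁆ ∈ 𝔥 ⊔ 𝔪₁ := h𝔪₁ ▸ 𝔨.lie_mem (h𝔥𝔨 hZ) (h𝔪𝔨 hX)
    obtain ⟨N, hN, U, hU, h2⟩ := Submodule.mem_sup.1 h1
    have h3 : N = 0 := h0 N hN (by
      rw [eq_sub_of_add_eq h2]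
      exact Submodule.sub_mem _ (hlie𝔪 Z hZ X (hm₁ hX)) (hm₁ hU))
    rw [← h2, h3, zero_add]
    exact hU
  have hlie𝔪₂ : ∀ Z ∈ 𝔥, ∀ X ∈ 𝔪₂, ⁅Z, X⁆ ∈ 𝔪₂ := by
    intro Z hZ X hX
    obtain ⟨U, hU, W, hW, h2⟩ := Submodule.mem_sup.1 (hlie𝔪 Z hZ X (hm₂ hX))
    -- The 𝔪₁-component `U` of [Z, X] satisfies q(U, U) = q(U, [Z, X]) = -q([Z, U], X) = 0, because
    -- [Z, U] ∈ 𝔪₁.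
    have h3 := hskew Z hZ U X
    rw [horth _ (hlie𝔪₁ Z hZ U hU) X hX, zero_add, ← h2, map_add, horth U hU W hW, add_zero] at h3
    have h4 := h0 U (hker.1 h3) (hm₁ hU)
    rw [← h2, h4, zero_add]
    exact hW
  have hy𝔨 : ∀ U ∈ 𝔨, ∀ j, q U (y j) = 0 := by
    intro U hU j
    obtain ⟨Z, hZ, V, hV, rfl⟩ := Submodule.mem_sup.1 (h𝔪₁.symm ▸ hU : U ∈ 𝔥 ⊔ 𝔪₁)
    rw [map_add, LinearMap.add_apply, h𝔥 Z hZ, horth V hV _ (ymem j), add_zero]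
  have hdec : ∀ V, V - (∑ i, q V (a i) • a i + ∑ j, q V (y j) • y j) ∈ 𝔥 := by
    intro V
    have hV : V ∈ 𝔥 ⊔ (𝔪₁ ⊔ 𝔪₂) := by
      rw [h𝔪, h𝔥compl.sup_eq_top]
      exact Submodule.mem_top
    obtain ⟨Z, hZ, T, hT, rfl⟩ := Submodule.mem_sup.1 hV
    obtain ⟨U, hU, W, hW, rfl⟩ := Submodule.mem_sup.1 hT
    have h1 : ∀ i, q (Z + (U + W)) (a i) = q U (a i) := fun i => by
      rw [map_add, map_add, LinearMap.add_apply, LinearMap.add_apply, h𝔥 Z hZ, hq W,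
        horth _ (ha i) W hW, zero_add, add_zero]
    have h2 : ∀ j, q (Z + (U + W)) (y j) = q W (y j) := fun j => by
      rw [map_add, map_add, LinearMap.add_apply, LinearMap.add_apply, h𝔥 Z hZ,
        horth U hU _ (ymem j), zero_add, zero_add]
    simp only [h1, h2]
    rw [← haexp U hU, ← hyexp W hW, add_sub_cancel_right]
    exact hZ
  refine ⟨hcompl, n, a, ha, haorth, hdec, fun U hU => ?_, fun X hX => ?_⟩
  · have h1 := hdec U
    rwa [Finset.sum_eq_zero (f := fun j => q U (y j) • y j) fun j _ => by
      rw [hy𝔨 U hU j, zero_smul], add_zero] at h1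
  · exact lieRicci_sumElim hq h𝔥 hskew h𝔥𝔨 a y (fun i => h𝔪𝔨 (ha i)) hy𝔨 hdec
      (fun Z hZ l => haexp _ (hlie𝔪₁ Z hZ _ (ha l)))
      (fun Z hZ l => hyexp _ (hlie𝔪₂ Z hZ _ (ymem l))) hGO (h𝔪𝔨 hX)

/-- Parseval's identity for a semi-definite form with null space `𝔥`. -/
theorem LinearMap.BilinForm.eq_sum_mul_of_sub_mem {q : LinearMap.BilinForm ℝ L}
    (hq : ∀ X Y, q X Y = q Y X) {𝔥 : Submodule ℝ L} (h𝔥 : ∀ Z ∈ 𝔥, ∀ X, q Z X = 0)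
    {κ : Type*} [Fintype κ] {e : κ → L} {X : L} (hX : X - ∑ k, q X (e k) • e k ∈ 𝔥) (Y : L) :
    q X Y = ∑ k, q X (e k) * q Y (e k) := by
  have h1 := h𝔥 _ hX Y
  rw [map_sub, LinearMap.sub_apply, sub_eq_zero] at h1
  rw [h1]
  simp only [map_sum, map_smul, LinearMap.sum_apply, LinearMap.smul_apply, smul_eq_mul]
  exact Finset.sum_congr rfl fun k _ => by rw [hq Y]

end ReductiveDecomposition

end

/-! ### The Ricci curvatures of M and M⋆. -/

theorem proposition3
    -- the semisimple Lie group `G`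
    {F : Type*} [NormedAddCommGroup F] [NormedSpace ℝ F] [FiniteDimensional ℝ F]
    {G : Type*} [TopologicalSpace G] [T2Space G] [ChartedSpace F G] [Group G]
    [LieGroup 𝓘(ℝ, F) ∞ G]
    [LieAlgebra.IsSemisimple ℝ (GroupLieAlgebra 𝓘(ℝ, F) G)]
    -- the geodesic orbit space `(M = G/H, g)`
    {E : Type*} [NormedAddCommGroup E] [NormedSpace ℝ E] [FiniteDimensional ℝ E]
    {M : Type*} [TopologicalSpace M] [T2Space M] [ChartedSpace E M] [IsManifold 𝓘(ℝ, E) ∞ M]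
    [MulAction G M] (g : RiemMetric E M) (o : M)
    (hM : IsHomogeneousRiemannianSpace F G g o)
    (hGO : IsGeodesicOrbit F G g)
    -- `𝔨`, maximal compactly embedded
    (𝔨 : LieSubalgebra ℝ (GroupLieAlgebra 𝓘(ℝ, F) G))
    (h𝔨 : Maximal IsCompactlyEmbedded 𝔨)
    -- the decompositions `𝔨 = 𝔥 ⊕ 𝔪₁` and `𝔪 = 𝔪₁ ⊕ 𝔪₂`
    (𝔪₁ 𝔪₂ : Submodule ℝ (GroupLieAlgebra 𝓘(ℝ, F) G))
    (h𝔪 : 𝔪₁ ⊔ 𝔪₂ = LinearMap.BilinForm.orthogonal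
      (killingForm ℝ (GroupLieAlgebra 𝓘(ℝ, F) G)) (isotropyAlgebra F G (E := E) o))
    (h𝔪₁ : isotropyAlgebra F G (E := E) o ⊔ 𝔪₁ = 𝔨.toSubmodule)
    (horth : ∀ X ∈ 𝔪₁, ∀ Y ∈ 𝔪₂, homInner F G g o X Y = 0)
    -- the orthonormal basis of `𝔪₂`
    {s : ℕ} (Y : Fin s → GroupLieAlgebra 𝓘(ℝ, F) G)
    (hYspan : Submodule.span ℝ (Set.range Y) = 𝔪₂)
    (hYorth : ∀ i j, homInner F G g o (Y i) (Y j) = if i = j then 1 else 0)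
    -- the compact Lie group `K⋆` with Lie algebra `𝔨`
    {F' : Type*} [NormedAddCommGroup F'] [NormedSpace ℝ F'] [FiniteDimensional ℝ F']
    {K : Type*} [TopologicalSpace K] [T2Space K] [CompactSpace K] [ChartedSpace F' K] [Group K]
    [LieGroup 𝓘(ℝ, F') ∞ K]
    (ι : GroupLieAlgebra 𝓘(ℝ, F') K ≃ₗ⁅ℝ⁆ 𝔨)
    -- the homogeneous space `(M⋆ = K⋆/H⋆, g⋆)`
    {E' : Type*} [NormedAddCommGroup E'] [NormedSpace ℝ E'] [FiniteDimensional ℝ E']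
    {M' : Type*} [TopologicalSpace M'] [T2Space M'] [ChartedSpace E' M']
    [IsManifold 𝓘(ℝ, E') ∞ M'] [MulAction K M'] (g' : RiemMetric E' M') (o' : M')
    (hM' : IsHomogeneousRiemannianSpace F' K g' o')
    (hιH : ∀ U, U ∈ isotropyAlgebra F' K (E := E') o' ↔
      (ι U : GroupLieAlgebra 𝓘(ℝ, F) G) ∈ isotropyAlgebra F G (E := E) o)
    (hιg : ∀ U V, (ι U : GroupLieAlgebra 𝓘(ℝ, F) G) ∈ 𝔪₁ →
      (ι V : GroupLieAlgebra 𝓘(ℝ, F) G) ∈ 𝔪₁ →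
      homInner F' K g' o' U V = homInner F G g o (ι U) (ι V)) :
    ∃ hcompl : IsCompl 𝔪₁ (isotropyAlgebra F G (E := E) o ⊔ 𝔪₂),
      ∀ (X : GroupLieAlgebra 𝓘(ℝ, F) G) (hX : X ∈ 𝔪₁),
        homRicci F' K g' o' (ι.symm ⟨X, h𝔪₁.le (Submodule.mem_sup_right hX)⟩) =
          homRicci F G g o X - (1 / 2) * ∑ i : Fin s, ∑ j ∈ Finset.Ioi i,
            (homInner F G g o (Submodule.projection 𝔪₁ (isotropyAlgebra F G (E := E) o ⊔ 𝔪₂) hcompl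
              ⁅Y i, Y j⁆) X) ^ 2 := by
  have hq : ∀ X Y, homForm F G g o X Y = homForm F G g o Y X := homForm_symm
  have h𝔥 : ∀ Z ∈ isotropyAlgebra F G (E := E) o, ∀ X, homForm F G g o Z X = 0 :=
    fun Z hZ X => homForm_eq_zero_of_mem hZ X
  have hgeod : ∀ X, ∃ Z ∈ isotropyAlgebra F G (E := E) o,
      ∀ W, homForm F G g o ⁅X + Z, W⁆ X = 0 := by
    intro X
    obtain ⟨A, hA, hW⟩ := hM.exists_geodesic_vector hGO X
    have hZ : A - X ∈ isotropyAlgebra F G (E := E) o := by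
      refine LinearMap.mem_ker.2 ?_
      rw [map_sub]
      exact sub_eq_zero.2 hA
    refine ⟨A - X, hZ, fun W => ?_⟩
    rw [add_sub_cancel, ← hW W, homForm_apply, homInner, homInner, hA]
  obtain ⟨hcompl, n, a, ha, haorth, hdec, hdec𝔨, hmain⟩ :=
    exists_adapted_basis (q := homForm F G g o) hq homForm_self_nonneg homForm_self_eq_zero h𝔥
      (fun Z hZ => hM.homForm_skew hZ)
      (isCompl_orthogonal_killingForm h𝔨.prop (h𝔪₁ ▸ le_sup_left)) h𝔪 h𝔪₁ horth hYspan hYorth hgeod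
  refine ⟨hcompl, fun X hX => ?_⟩
  have ymem : ∀ j, Y j ∈ 𝔪₂ := fun j => hYspan ▸ Submodule.subset_span ⟨j, rfl⟩
  -- the Ricci curvature of `M`
  have hRic : homRicci F G g o X = lieRicci (homForm F G g o) (Sum.elim a Y) X := by
    refine hM.homRicci_eq_sum (Sum.elim a Y) ?_ ?_ X
    · rintro (i | i) (j | j)
      · simpa using haorth i j
      · simpa [homForm_apply] using horth _ (ha i) _ (ymem j)
      · simpa using (hq _ _).trans (horth _ (ha j) _ (ymem i))
      · simpa [homForm_apply] using hYorth i j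
    · intro U V
      refine LinearMap.BilinForm.eq_sum_mul_of_sub_mem hq h𝔥 ?_ V
      simpa only [Fintype.sum_sum_type, Sum.elim_inl, Sum.elim_inr] using hdec U
  -- the Ricci curvature of the compact quotient
  have h𝔪𝔨 : ∀ U ∈ 𝔪₁, U ∈ 𝔨 := fun U hU => h𝔪₁.le (Submodule.mem_sup_right hU)
  -- The metrics are assumed to agree only on 𝔪₁; they agree on all of 𝔨 because both forms vanish
  -- on the isotropy algebra, which `ι` identifies.
  have hq' : ∀ U V, homForm F' K g' o' U V = homForm F G g o (ι U) (ι V) := by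
    have hsplit : ∀ U, ∃ Z T, U = Z + T ∧ Z ∈ isotropyAlgebra F' K (E := E') o' ∧
        ((ι Z : 𝔨) : GroupLieAlgebra 𝓘(ℝ, F) G) ∈ isotropyAlgebra F G (E := E) o ∧
        ((ι T : 𝔨) : GroupLieAlgebra 𝓘(ℝ, F) G) ∈ 𝔪₁ := by
      intro U
      obtain ⟨Z, hZ, T, hT, h1⟩ := Submodule.mem_sup.1 (h𝔪₁.symm ▸ (ι U).2 :
        ((ι U : 𝔨) : GroupLieAlgebra 𝓘(ℝ, F) G) ∈ isotropyAlgebra F G (E := E) o ⊔ 𝔪₁)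
      have hZ𝔨 : Z ∈ 𝔨 := h𝔪₁.le (Submodule.mem_sup_left hZ)
      refine ⟨ι.symm ⟨Z, hZ𝔨⟩, ι.symm ⟨T, h𝔪𝔨 T hT⟩, ?_, ?_, ?_, ?_⟩
      · refine ι.injective (?_ : ι U = ι _)
        rw [map_add, LieEquiv.apply_symm_apply, LieEquiv.apply_symm_apply]
        exact Subtype.ext h1.symm
      · rw [hιH, LieEquiv.apply_symm_apply]; exact hZ
      · rw [LieEquiv.apply_symm_apply]; exact hZ
      · rw [LieEquiv.apply_symm_apply]; exact hT
    intro U V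
    obtain ⟨Z, T, rfl, hZ, hιZ, hT⟩ := hsplit U
    obtain ⟨Z', T', rfl, hZ', hιZ', hT'⟩ := hsplit V
    have e1 : homForm F' K g' o' (Z + T) (Z' + T') = homForm F' K g' o' T T' := by
      rw [LinearMap.BilinForm.add_left, homForm_eq_zero_of_mem hZ, zero_add,
        LinearMap.BilinForm.add_right, homForm_symm T Z', homForm_eq_zero_of_mem hZ', zero_add]
    have e2 : homForm F G g o (ι (Z + T) : 𝔨) (ι (Z' + T') : 𝔨) =
        homForm F G g o (ι T : 𝔨) (ι T' : 𝔨) := by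
      rw [map_add, map_add, AddMemClass.coe_add, AddMemClass.coe_add,
        LinearMap.BilinForm.add_left, homForm_eq_zero_of_mem hιZ, zero_add,
        LinearMap.BilinForm.add_right,
        hq _ ((ι Z' : 𝔨) : GroupLieAlgebra 𝓘(ℝ, F) G), homForm_eq_zero_of_mem hιZ', zero_add]
    rw [e1, e2]
    exact hιg T T' hT hT'
  set e : Fin n → GroupLieAlgebra 𝓘(ℝ, F') K := fun i => ι.symm ⟨a i, h𝔪𝔨 _ (ha i)⟩ with he
  have hιe : ∀ i, ((ι (e i) : 𝔨) : GroupLieAlgebra 𝓘(ℝ, F) G) = a i := fun i => by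
    rw [he, LieEquiv.apply_symm_apply]
  have hlie : ∀ U V, ((ι ⁅U, V⁆ : 𝔨) : GroupLieAlgebra 𝓘(ℝ, F) G) = ⁅(ι U : 𝔨).1, (ι V : 𝔨).1⁆ :=
    fun U V => congrArg Subtype.val (LieEquiv.map_lie ι U V)
  have hRic' : homRicci F' K g' o' (ι.symm ⟨X, h𝔪₁.le (Submodule.mem_sup_right hX)⟩) =
      lieRicci (homForm F G g o) a X := by
    rw [hM'.homRicci_eq_sum e (fun i j => by rw [hq', hιe, hιe, haorth]) (fun U V => by
      simp only [hq', hιe]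
      exact LinearMap.BilinForm.eq_sum_mul_of_sub_mem hq h𝔥 (hdec𝔨 _ (ι U).2) _), lieRicci]
    simp only [hq', hlie, hιe, LieEquiv.apply_symm_apply]
  -- The discarded part of `V` lies in 𝔥 + 𝔪₂, which is `q`-orthogonal to `X ∈ 𝔪₁`.
  have hproj : ∀ V, homInner F G g o (Submodule.projection 𝔪₁
      (isotropyAlgebra F G (E := E) o ⊔ 𝔪₂) hcompl V) X = homForm F G g o V X := by
    intro V
    obtain ⟨Z, hZ, W, hW, h1⟩ := Submodule.mem_sup.1 (Submodule.sub_projection_mem hcompl V)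
    have h2 : homForm F G g o (V - Submodule.projection 𝔪₁
        (isotropyAlgebra F G (E := E) o ⊔ 𝔪₂) hcompl V) X = 0 := by
      rw [← h1, map_add, LinearMap.add_apply, h𝔥 Z hZ, zero_add, hq]
      exact horth X hX W hW
    rw [map_sub, LinearMap.sub_apply, sub_eq_zero] at h2
    rw [h2, homForm_apply]
  rw [hRic, hRic', hmain X hX]
  simp only [hproj]
  exact (add_sub_cancel_right _ _).symm
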